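/- **Proposition (Propagation of moments).** Setting: $\mathbb R^3$ carries the Euclidean norm, $d\sigma$ is the surface measure of $\mathbb S^2$, $q=v-w$, $\langle v\rangle=\sqrt{1+|v|^2}$ and $\|g\|_{L^1_\eta}=\int_{\mathbb R^3}|g(v)|\langle v\rangle^\eta\,dv$. Let $\alpha\in(0,1)$ (mass ratio), $\beta\in[0,\tfrac12)$ (inelasticity parameter of the collisions with the host medium), $\epsilon\in(0,1)$ (restitution coefficient of the granular particles), $\zeta=\frac{1+\epsilon}{2}$, $\tau\ge 0$ and $\lambda>0$. Let $\mathbf F_1\ge 0$ be a measurable function on $\mathbb R^3$ with $\int\mathbf F_1=1$ all of whose moments $M_s=\int |w|^{2s}\mathbf F_1(w)\,dw$, $s\ge 0$, are finite. For $\psi:\mathbb R^3\to\mathbb R$ put $$\mathcal A_\zeta[\psi](v,w)=\frac1{4\pi}\int_{\mathbb S^2}\big(\psi(v')+\psi(w')-\psi(v)-\psi(w)\big)d\sigma,\qquad v'=v+\tfrac{\zeta}{2}(|q|\sigma-q),\quad w'=w-\tfrac{\zeta}{2}(|q|\sigma-q),$$ $$\mathcal J_e[\psi](v,w)=\frac1{4\pi}\int_{\mathbb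 S^2}\big(\psi(\tilde v^\star)-\psi(v)\big)d\sigma,\qquad \tilde v^\star=v-\alpha(1-\beta)(q-|q|\sigma).$$ Let $f$ be a nonnegative solution with unit mass, $\int f(v,0)\,dv=1$, of $\partial_t f=\tau\mathcal Q(f,f)+\mathcal L(f)$, where $\mathcal Q$ is the inelastic hard-sphere collision operator and $\mathcal L$ the linear scattering operator with host distribution $\mathbf F_1$. That is, $f\in\mathcal C([0,T];L^1_2)\cap L^\infty(0,T;L^1_3)$ for every $T>0$ and, for every $\psi\in C_c^\infty(\mathbb R^3)$ and $t\ge0$ (with the one-sided derivative at $t=0$), $$\frac{d}{dt}\int f(v,t)\psi(v)\,dv=\frac\tau2\iint f(v,t)f(w,t)|q|\,\mathcal A_\zeta[\psi](v,w)\,dw\,dv+\frac1\lambda\iint |q|f(v,t)\mathbf F_1(w)\,\mathcal J_e[\psi](v,w)\,dw\,dv .$$ For real $r\ge1$ let $Y_r(t)=\int_{\mathbb R^3} f(v,t)|v|^{2r}\,dv\in[0,\infty]$. For every $r\ge 1$ there are positive constants $C_r,K_r$, depending only on $r,\alpha,\beta,\tau,\lambda$ and the moments $M_s$ of $\mathbf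 F_1$, and a positive constant $A_r$, depending only on the same quantities and, when $\tau>0$, on an upper bound $E$ for the initial energy $\int f(v,0)|v|^2dv$, such that for every such solution $f$: 1. for every $t>0$, $Y_r(t)<\infty$, $Y_r$ is differentiable at $t$, and $$\frac{d}{dt}Y_r(t)\le C_r+A_rY_r(t)-K_rY_r(t)^{1+\frac1{2r}};$$ at $t=0$ the same inequality holds, whenever $Y_r(0)<\infty$, for the upper right Dini derivative $\limsup_{h\to0^+}\frac{Y_r(h)-Y_r(0)}{h}$. 2. If $Y_r(0)<\infty$, then $\sup_{t\ge0}Y_r(t)<\infty$. The case $\tau=0$ is included; then $A_r$ does not depend on $E$ either. -/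

import Mathlib

open MeasureTheory Filter Topology Set
open scoped NNReal ENNReal

namespace GranularBath

noncomputable section

/-- The velocity space `ℝ³` with its Euclidean norm. -/
abbrev Vel : Type := EuclideanSpace ℝ (Fin 3)

/-- The average `(1 / 4π) ∫_{𝕊²} g(σ) dσ` with respect to the surface measure of the unit sphere. -/
def sphereAvg (g : Vel → ℝ) : ℝ :=
  (4 * Real.pi)⁻¹ * ∫ σ : Metric.sphere (0 : Vel) 1, g (σ : Vel) ∂((volume : Measure Vel).toSphere)

/-- Post-collisional velocity `v' = v + (ζ/2) (|q| σ - q)` of the first particle in a collision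
between two granular particles, where `q = v - w`. -/
def postV (ζ : ℝ) (v w σ : Vel) : Vel :=
  v + (ζ / 2) • (‖v - w‖ • σ - (v - w))

/-- Post-collisional velocity `w' = w - (ζ/2) (|q| σ - q)` of the second particle in a collision
between two granular particles, where `q = v - w`. -/
def postW (ζ : ℝ) (v w σ : Vel) : Vel :=
  w - (ζ / 2) • (‖v - w‖ • σ - (v - w))

/-- `𝒜_ζ[ψ](v,w) = (1/4π) ∫ (ψ(v') + ψ(w') - ψ(v) - ψ(w)) dσ`. -/
def collA (ζ : ℝ) (ψ : Vel → ℝ) (v w : Vel) : ℝ :=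
  sphereAvg fun σ => ψ (postV ζ v w σ) + ψ (postW ζ v w σ) - ψ v - ψ w

/-- Post-collisional velocity `v - α (1 - β) (q - |q| σ)` of a granular particle hitting a
particle of the host medium, where `q = v - w`, `α` is the mass ratio and `β` the inelasticity
parameter. -/
def postBath (α β : ℝ) (v w σ : Vel) : Vel :=
  v - (α * (1 - β)) • ((v - w) - ‖v - w‖ • σ)

/-- `𝒥_e[ψ](v,w) = (1/4π) ∫ (ψ(ṽ*) - ψ(v)) dσ`. -/
def collJ (α β : ℝ) (ψ : Vel → ℝ) (v w : Vel) : ℝ :=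
  sphereAvg fun σ => ψ (postBath α β v w σ) - ψ v

/-- `∫ 𝒬(f,f) ψ dv`, in the symmetrized weak form, for restitution coefficient `ε`,
`ζ = (1 + ε) / 2`. -/
def weakQ (ε : ℝ) (f ψ : Vel → ℝ) : ℝ :=
  (1 / 2) * ∫ v, ∫ w, f v * f w * ‖v - w‖ * collA ((1 + ε) / 2) ψ v w

/-- `∫ ℒ(f) ψ dv`, in weak form, for the host distribution `F₁` and the mean free path `lam`. -/
def weakL (α β lam : ℝ) (F₁ f ψ : Vel → ℝ) : ℝ :=
  (1 / lam) * ∫ v, ∫ w, ‖v - w‖ * f v * F₁ w * collJ α β ψ v w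

/-- The weighted norm `‖g‖_{L¹_η} = ∫ |g(v)| ⟨v⟩^η dv ∈ [0,∞]`, where `⟨v⟩ = √(1 + |v|²)`. -/
def normL1 (η : ℝ) (g : Vel → ℝ) : ℝ≥0∞ :=
  ∫⁻ v, ENNReal.ofReal (|g v| * Real.sqrt (1 + ‖v‖ ^ 2) ^ η)

/-- The moment `∫ g(v) |v|^{2s} dv ∈ [0,∞]` of a nonnegative function `g`. -/
def moment (g : Vel → ℝ) (s : ℝ) : ℝ≥0∞ :=
  ∫⁻ v, ENNReal.ofReal (g v * ‖v‖ ^ (2 * s))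

/-- `F₁` is a nonnegative, normalized distribution function. -/
structure IsDistribution (F₁ : Vel → ℝ) : Prop where
  aemeasurable : AEMeasurable F₁
  nonneg : ∀ᵐ v, 0 ≤ F₁ v
  mass : ∫⁻ v, ENNReal.ofReal (F₁ v) = 1

/-- `f` is a nonnegative solution, with unit initial mass, to `∂ₜ f = τ 𝒬(f,f) + ℒ(f)` on
`[0,∞)`: for every `T > 0` it belongs to `𝒞([0,T]; L¹₂) ∩ L^∞(0,T; L¹₃)`, and the equation holds
in weak form, tested against smooth compactly supported functions of `v`. -/
structure IsSolution (τ lam α β ε : ℝ) (F₁ : Vel → ℝ) (f : ℝ → Vel → ℝ) : Prop where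
  aemeasurable : ∀ t, 0 ≤ t → AEMeasurable (f t)
  nonneg : ∀ t, 0 ≤ t → ∀ᵐ v, 0 ≤ f t v
  mass : ∫⁻ v, ENNReal.ofReal (f 0 v) = 1
  normL1_two_lt_top : ∀ t, 0 ≤ t → normL1 2 (f t) < ∞
  continuous : ∀ t, 0 ≤ t →
    Tendsto (fun s => normL1 2 fun v => f s v - f t v) (𝓝[Ici 0] t) (𝓝 0)
  bounded : ∀ T : ℝ, 0 < T →
    ∃ B : ℝ≥0, ∀ᵐ t ∂(volume.restrict (Icc 0 T)), normL1 3 (f t) ≤ B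
  equation : ∀ ψ : Vel → ℝ, ContDiff ℝ (⊤ : ℕ∞) ψ → HasCompactSupport ψ → ∀ t, 0 ≤ t →
    HasDerivWithinAt (fun s => ∫ v, f s v * ψ v)
      (τ * weakQ ε (f t) ψ + weakL α β lam F₁ (f t) ψ) (Ici 0) t

/-- The upper right Dini derivative `limsup_{h → 0⁺} (y(t + h) - y(t)) / h ∈ [-∞, ∞]`. -/
def upperRightDeriv (y : ℝ → ℝ) (t : ℝ) : EReal :=
  limsup (fun h : ℝ => (((y (t + h) - y t) / h : ℝ) : EReal)) (𝓝[>] 0)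

end

end GranularBath

/-! The superlinear damping comes entirely from the host medium. Put `κ = α(1-β) ∈ (0,1)`. When `v`
is large compared with `w`, the post-collisional velocity is close to `a = (1-κ)v + κ|v|σ`, and
`|a|² = (1-2κ(1-κ))|v|² + 2κ(1-κ)|v| v·σ`. The average over `σ` kills the last term, so a power of
`|v|²` loses a fixed fraction, up to an error in `w` controlled by the moments of the host
(`exists_collJ_le`). The factor `|q| ≥ |v| - |w|` adds one power of `|v|` to this loss, and Jensen's
inequality turns it into `-K Y^(1+1/(2r))` (`rpow_integral_le`).

Granular collisions need no angular gain. They dissipate `|v|² + |w|²`, and superadditivity of the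
power leaves only mixed terms (`collA_le`), which are at most linear in `Y` once the energy is
bounded (`mul_weakQ_le`). For `r = 1` their contribution is nonpositive, so the energy is bounded
beforehand from its initial value alone (`energy_le`).

Moments are not known to be finite at the start. All estimates are therefore proved for the class
`IsPowerLike r`, which contains both `x^r` and its linear continuations `truncPow r n`, with
constants independent of `n`. The truncated test functions grow like `|v|²`, so the bound in `L¹₃`
suffices to use them in the weak formulation (`IsSolution.weak_form`). The truncated moments then
satisfy an integrated differential inequality. Comparison with a constant gives propagation, and
comparison with `c (t-a)^(-2r)`, which is infinite at the initial time `a`, gives finiteness of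
every moment for `t > 0` (`le_rpow_of_sub_le_integral`). Letting `n → ∞` carries both bounds to the
true moments.

Once all moments are locally bounded on `(0,∞)`, the weak formulation can be differentiated with the
full power as test function (`IsSolution.hasDerivAt_integral`), and the same class estimate gives
the inequality for `Y_r`. At `t = 0`, right continuity of `Y_r` and the mean value theorem give the
Dini bound. -/

namespace GranularBath

/-! ### Averages over the unit sphere -/

/-- The normalized surface measure of the unit sphere. -/
noncomputable def sphereProb : Measure (Metric.sphere (0 : Vel) 1) :=
  ENNReal.ofReal (4 * Real.pi)⁻¹ • (volume : Measure Vel).toSphere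

lemma sphereAvg_eq (g : Vel → ℝ) : sphereAvg g = ∫ σ, g σ ∂sphereProb := by
  have : 0 ≤ (4 * Real.pi)⁻¹ := by positivity
  rw [sphereAvg, sphereProb, integral_smul_measure, ENNReal.toReal_ofReal this, smul_eq_mul]

instance : IsProbabilityMeasure sphereProb := by
  constructor
  have hpi := Real.pi_pos
  rw [sphereProb, Measure.smul_apply, Measure.toSphere_apply_univ,
    EuclideanSpace.volume_ball_fin_three]
  simp only [finrank_euclideanSpace, Fintype.card_fin, smul_eq_mul]
  rw [show ((3 : ℕ) : ℝ≥0∞) = ENNReal.ofReal 3 by simp, ← ENNReal.ofReal_pow (by norm_num),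
    ← ENNReal.ofReal_mul (by positivity), ← ENNReal.ofReal_mul (by positivity),
    ← ENNReal.ofReal_mul (by positivity), ← ENNReal.ofReal_one]
  congr 1
  field_simp

/-- The surface measure of a set is a multiple of the volume of the cone over it, and Lebesgue
measure is invariant under `x ↦ -x`. -/
lemma measurePreserving_neg_sphere :
    MeasurePreserving (fun σ : Metric.sphere (0 : Vel) 1 => -σ) sphereProb sphereProb := by
  have hm : Measurable (fun σ : Metric.sphere (0 : Vel) 1 => -σ) := by
    refine Measurable.subtype_mk ?_
    exact measurable_subtype_coe.neg
  refine ⟨hm, ?_⟩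
  ext s hs
  rw [Measure.map_apply hm hs, sphereProb, Measure.smul_apply, Measure.smul_apply,
    Measure.toSphere_apply' _ (hm hs), Measure.toSphere_apply' _ hs]
  congr 2
  rw [← Measure.measure_neg]
  congr 1
  ext x
  simp only [Set.mem_neg, Set.mem_smul, Set.mem_image, Set.mem_preimage]
  constructor
  · rintro ⟨a, ha, y, ⟨σ, hσ, rfl⟩, h⟩
    refine ⟨a, ha, _, ⟨-σ, hσ, rfl⟩, ?_⟩
    rw [← neg_neg x, ← h]; simp
  · rintro ⟨a, ha, y, ⟨σ, hσ, rfl⟩, h⟩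
    refine ⟨a, ha, _, ⟨-σ, by simpa using hσ, rfl⟩, ?_⟩
    rw [← h]; simp

lemma integral_inner_sphere (a : Vel) : ∫ σ, inner ℝ a (σ : Vel) ∂sphereProb = 0 := by
  have h := measurePreserving_neg_sphere.integral_comp
    (Homeomorph.neg (Metric.sphere (0 : Vel) 1)).measurableEmbedding
    (fun σ => inner ℝ a (σ : Vel))
  have h2 : ∀ σ : Metric.sphere (0 : Vel) 1,
      inner ℝ a ((-σ : Metric.sphere (0 : Vel) 1) : Vel) = -inner ℝ a (σ : Vel) := fun σ => by
    simp
  rw [integral_congr_ae (.of_forall h2), integral_neg] at h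
  linarith

lemma integrable_sphere {g : Vel → ℝ} (hg : Continuous g) :
    Integrable (fun σ : Metric.sphere (0 : Vel) 1 => g σ) sphereProb :=
  (hg.comp continuous_subtype_val).integrable_of_hasCompactSupport
    (HasCompactSupport.of_compactSpace _)

lemma sphereAvg_mono {g h : Vel → ℝ} (hg : Continuous g) (hh : Continuous h)
    (H : ∀ σ : Vel, ‖σ‖ = 1 → g σ ≤ h σ) : sphereAvg g ≤ sphereAvg h := by
  rw [sphereAvg_eq, sphereAvg_eq]
  exact integral_mono (integrable_sphere hg) (integrable_sphere hh)
    fun σ => H σ (by simp)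

lemma sphereAvg_const (c : ℝ) : sphereAvg (fun _ => c) = c := by
  simp [sphereAvg_eq]

lemma sphereAvg_le {g : Vel → ℝ} (hg : Continuous g) {c : ℝ}
    (H : ∀ σ : Vel, ‖σ‖ = 1 → g σ ≤ c) : sphereAvg g ≤ c :=
  (sphereAvg_mono hg continuous_const H).trans_eq (sphereAvg_const c)

lemma abs_sphereAvg_le {g : Vel → ℝ} {c : ℝ} (H : ∀ σ : Vel, ‖σ‖ = 1 → |g σ| ≤ c) :
    |sphereAvg g| ≤ c := by
  rw [sphereAvg_eq, ← Real.norm_eq_abs]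
  refine (norm_integral_le_of_norm_le_const (C := c) ?_).trans_eq (by simp)
  exact .of_forall fun σ => H σ (by simp)

lemma tendsto_sphereAvg {g : ℕ → Vel → ℝ} {h : Vel → ℝ} (hg : ∀ n, Continuous (g n)) (c : ℝ)
    (hc : ∀ n, ∀ σ : Vel, ‖σ‖ = 1 → |g n σ| ≤ c)
    (H : ∀ σ : Vel, ‖σ‖ = 1 → Tendsto (fun n => g n σ) atTop (𝓝 (h σ))) :
    Tendsto (fun n => sphereAvg (g n)) atTop (𝓝 (sphereAvg h)) := by
  simp only [sphereAvg_eq]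
  refine tendsto_integral_of_dominated_convergence (fun _ => c)
    (fun n => (integrable_sphere (hg n)).aestronglyMeasurable) (integrable_const c) ?_ ?_
  · exact fun n => .of_forall fun σ => hc n σ (by simp)
  · exact .of_forall fun σ => H σ (by simp)

lemma stronglyMeasurable_sphereAvg {X : Type*} [MeasurableSpace X] [TopologicalSpace X]
    [OpensMeasurableSpace X] [SecondCountableTopology X] {g : X → Vel → ℝ}
    (hg : Continuous (Function.uncurry g)) :
    StronglyMeasurable fun x => sphereAvg (g x) := by
  simp only [sphereAvg_eq]
  refine StronglyMeasurable.integral_prod_right'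
    (f := fun p : X × Metric.sphere (0 : Vel) 1 => g p.1 p.2) ?_
  refine Continuous.stronglyMeasurable ?_
  exact hg.comp (continuous_fst.prodMk (continuous_subtype_val.comp continuous_snd))

/-! ### Powers and their truncations -/

/-- Functions `φ` on `[0,∞)` which behave like truncations of `x ^ r`. -/
structure IsPowerLike (r : ℝ) (φ : ℝ → ℝ) : Prop where
  cont : Continuous φ
  nonneg : ∀ x, 0 ≤ x → 0 ≤ φ x
  star : ∀ s x, 0 ≤ s → s ≤ 1 → 0 ≤ x → φ (s * x) ≤ s * φ x
  dilate : ∀ θ x, 1 ≤ θ → 0 ≤ x → φ (θ * x) ≤ θ ^ r * φ x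
  le_rpow : ∀ x, 0 ≤ x → φ x ≤ x ^ r
  le_one_add : ∀ x, 0 ≤ x → x ≤ 1 + φ x

/-- The function `x ^ r`, continued linearly in `x` beyond `x = n`. -/
noncomputable def truncPow (r n x : ℝ) : ℝ := x * (max (min x n) 0) ^ (r - 1)

lemma isPowerLike_rpow {r : ℝ} (hr : 1 ≤ r) : IsPowerLike r (fun x => x ^ r) where
  cont := Real.continuous_rpow_const (by linarith)
  nonneg x hx := Real.rpow_nonneg hx _
  star s x h0 h1 hx := by
    rw [Real.mul_rpow h0 hx]
    refine mul_le_mul_of_nonneg_right ?_ (Real.rpow_nonneg hx _)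
    simpa using Real.rpow_le_rpow_of_exponent_ge' h0 h1 zero_le_one hr
  dilate θ x h1 hx := (Real.mul_rpow (by linarith) hx).le
  le_rpow x hx := le_rfl
  le_one_add x hx := by
    rcases le_total x 1 with h | h
    · linarith [Real.rpow_nonneg hx r]
    · have := Real.rpow_le_rpow_of_exponent_le h hr
      simp only [Real.rpow_one] at this
      linarith

lemma isPowerLike_truncPow {r n : ℝ} (hr : 1 ≤ r) (hn : 1 ≤ n) :
    IsPowerLike r (truncPow r n) where
  cont := by
    refine continuous_id.mul ?_
    exact (Real.continuous_rpow_const (by linarith)).comp (by fun_prop)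
  nonneg x hx := mul_nonneg hx (by positivity)
  star s x h0 h1 hx := by
    rw [truncPow, truncPow, mul_assoc]
    refine mul_le_mul_of_nonneg_left (mul_le_mul_of_nonneg_left ?_ hx) h0
    refine Real.rpow_le_rpow (by positivity) ?_ (by linarith)
    gcongr
    exact mul_le_of_le_one_left hx h1
  dilate θ x h1 hx := by
    have hθ : 0 < θ := by linarith
    -- Pulling out `θ ≥ 1` only raises the cap from `n` to `θ n`.
    have h2 : max (min (θ * x) n) 0 ≤ θ * max (min x n) 0 := by
      rw [max_eq_left (le_min (by positivity) (by linarith)),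
        max_eq_left (le_min (by positivity) (by linarith)), mul_min_of_nonneg _ _ hθ.le]
      exact min_le_min le_rfl (le_mul_of_one_le_left (by linarith) h1)
    calc truncPow r n (θ * x) ≤ (θ * x) * (θ * max (min x n) 0) ^ (r - 1) := by
          refine mul_le_mul_of_nonneg_left ?_ (by positivity)
          exact Real.rpow_le_rpow (by positivity) h2 (by linarith)
      _ = θ ^ r * truncPow r n x := by
          rw [Real.mul_rpow hθ.le (by positivity), truncPow,
            show θ ^ r = θ * θ ^ (r - 1) by
              rw [Real.rpow_sub_one hθ.ne']; field_simp]
          ring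
  le_rpow x hx := by
    rcases hx.eq_or_lt with rfl | hx'
    · simp [truncPow]; positivity
    have : max (min x n) 0 ≤ x := max_le (min_le_left _ _) hx
    calc truncPow r n x ≤ x * x ^ (r - 1) :=
          mul_le_mul_of_nonneg_left (Real.rpow_le_rpow (by positivity) this (by linarith)) hx
      _ = x ^ r := by rw [Real.rpow_sub_one hx'.ne']; field_simp
  le_one_add x hx := by
    rcases le_total x 1 with h | h
    · have : 0 ≤ truncPow r n x := mul_nonneg hx (by positivity)
      linarith
    · have : 1 ≤ (max (min x n) 0) ^ (r - 1) :=
        Real.one_le_rpow (le_max_of_le_left (le_min h hn)) (by linarith)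
      have := le_mul_of_one_le_right hx this
      rw [truncPow]; linarith

lemma truncPow_eq_rpow {r n x : ℝ} (hr : 1 ≤ r) (hx : 0 ≤ x) (hn : x ≤ n) :
    truncPow r n x = x ^ r := by
  rcases hx.eq_or_lt with rfl | hx'
  · simp [truncPow, Real.zero_rpow (by linarith : r ≠ 0)]
  · rw [truncPow, min_eq_left hn, max_eq_left hx, Real.rpow_sub_one hx'.ne']; field_simp

lemma truncPow_le_mul {r n x : ℝ} (hr : 1 ≤ r) (hx : 0 ≤ x) (hn : 0 ≤ n) :
    truncPow r n x ≤ n ^ (r - 1) * x := by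
  rw [truncPow, mul_comm]
  exact mul_le_mul_of_nonneg_right
    (Real.rpow_le_rpow (by positivity) (max_le (min_le_right _ _) hn) (by linarith)) hx

namespace IsPowerLike
variable {r : ℝ} {φ : ℝ → ℝ}

lemma mono (h : IsPowerLike r φ) {x y : ℝ} (hx : 0 ≤ x) (hxy : x ≤ y) : φ x ≤ φ y := by
  rcases (hx.trans hxy).eq_or_lt with rfl | hy
  · rw [le_antisymm hxy hx]
  have := h.star (x / y) y (by positivity) (div_le_one_of_le₀ hxy hy.le) hy.le
  rw [div_mul_cancel₀ _ hy.ne'] at this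
  exact this.trans (mul_le_of_le_one_left (h.nonneg _ hy.le) (div_le_one_of_le₀ hxy hy.le))

lemma superadd (h : IsPowerLike r φ) {x y : ℝ} (hx : 0 ≤ x) (hy : 0 ≤ y) :
    φ x + φ y ≤ φ (x + y) := by
  rcases (add_nonneg hx hy).eq_or_lt with h0 | hs
  · have hx0 : x = 0 := by linarith
    have hy0 : y = 0 := by linarith
    subst hx0 hy0
    have := h.star 0 0 le_rfl zero_le_one le_rfl
    simp only [zero_mul, add_zero] at this ⊢
    linarith
  have h1 := h.star (x / (x + y)) (x + y) (by positivity)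
    (div_le_one_of_le₀ (by linarith) hs.le) hs.le
  have h2 := h.star (y / (x + y)) (x + y) (by positivity)
    (div_le_one_of_le₀ (by linarith) hs.le) hs.le
  rw [div_mul_cancel₀ _ hs.ne'] at h1 h2
  have : x / (x + y) * φ (x + y) + y / (x + y) * φ (x + y) = φ (x + y) := by
    field_simp
  linarith

lemma map_zero (h : IsPowerLike r φ) : φ 0 = 0 := by
  have := h.star 0 0 le_rfl zero_le_one le_rfl
  have := h.nonneg 0 le_rfl
  simp only [zero_mul] at *
  linarith

/-- Dilating `x` by `1 + y/x ∈ [1,2]` costs `(1 + y/x)^r`, which by convexity lies below the chord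
of the power over `[1,2]`. -/
lemma map_add_le (h : IsPowerLike r φ) (hr : 1 ≤ r) {x y : ℝ} (hx : 0 < x) (hy : 0 ≤ y)
    (hyx : y ≤ x) : φ (x + y) ≤ φ x + 2 ^ r * (y / x) * φ x := by
  have ht0 : 0 ≤ y / x := by positivity
  have ht1 : y / x ≤ 1 := div_le_one_of_le₀ hyx hx.le
  have h1 := h.dilate (1 + y / x) x (by linarith) hx.le
  have h2 := (convexOn_rpow hr).2 (x := 1) (y := 2) (by simp) (by simp)
    (sub_nonneg.2 ht1) ht0 (by ring)
  simp only [smul_eq_mul, Real.one_rpow] at h2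
  rw [show (1 - y / x) * 1 + y / x * 2 = 1 + y / x by ring] at h2
  rw [show (1 + y / x) * x = x + y by field_simp] at h1
  have h3 : (1 + y / x) ^ r ≤ 1 + 2 ^ r * (y / x) := by linarith
  have := mul_le_mul_of_nonneg_right h3 (h.nonneg x hx.le)
  linarith

end IsPowerLike

/-! ### Pointwise estimates of the collision averages -/

lemma norm_sq_postV_add_postW_le {ζ : ℝ} (h0 : 0 ≤ ζ) (h1 : ζ ≤ 1) (v w σ : Vel)
    (hσ : ‖σ‖ = 1) :
    ‖postV ζ v w σ‖ ^ 2 + ‖postW ζ v w σ‖ ^ 2 ≤ ‖v‖ ^ 2 + ‖w‖ ^ 2 := by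
  set u : Vel := ‖v - w‖ • σ - (v - w) with hu
  have hu2 : ‖u‖ ^ 2 = -2 * inner ℝ (v - w) u := by
    rw [hu]
    generalize v - w = q
    rw [norm_sub_sq_real, inner_sub_right, norm_smul, hσ, real_inner_self_eq_norm_sq,
      real_inner_smul_left, real_inner_smul_right, real_inner_comm σ]
    simp
    ring
  rw [postV, postW, ← hu, norm_add_sq_real, norm_sub_sq_real, real_inner_smul_right,
    real_inner_smul_right, norm_smul, mul_pow]
  rw [inner_sub_left] at hu2
  have : 0 ≤ ζ * (1 - ζ) * ‖u‖ ^ 2 :=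
    mul_nonneg (mul_nonneg h0 (by linarith)) (sq_nonneg _)
  simp only [Real.norm_eq_abs, sq_abs]
  nlinarith

lemma continuous_comp_norm_sq {r : ℝ} {φ : ℝ → ℝ} (h : IsPowerLike r φ) :
    Continuous fun v : Vel => φ (‖v‖ ^ 2) :=
  h.cont.comp (by fun_prop)

lemma continuous_postV (ζ : ℝ) :
    Continuous fun p : (Vel × Vel) × Vel => postV ζ p.1.1 p.1.2 p.2 := by
  unfold postV; fun_prop

lemma continuous_postW (ζ : ℝ) :
    Continuous fun p : (Vel × Vel) × Vel => postW ζ p.1.1 p.1.2 p.2 := by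
  unfold postW; fun_prop

lemma continuous_postBath (α β : ℝ) :
    Continuous fun p : (Vel × Vel) × Vel => postBath α β p.1.1 p.1.2 p.2 := by
  unfold postBath; fun_prop

lemma continuous_collA_integrand {ψ : Vel → ℝ} (hψ : Continuous ψ) (ζ : ℝ) :
    Continuous (Function.uncurry fun (p : Vel × Vel) σ =>
      ψ (postV ζ p.1 p.2 σ) + ψ (postW ζ p.1 p.2 σ) - ψ p.1 - ψ p.2) := by
  have h1 := hψ.comp (continuous_postV ζ)
  have h2 := hψ.comp (continuous_postW ζ)
  exact ((h1.add h2).sub (hψ.comp (by fun_prop))).sub (hψ.comp (by fun_prop))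

lemma continuous_collJ_integrand {ψ : Vel → ℝ} (hψ : Continuous ψ) (α β : ℝ) :
    Continuous (Function.uncurry fun (p : Vel × Vel) σ =>
      ψ (postBath α β p.1 p.2 σ) - ψ p.1) :=
  (hψ.comp (continuous_postBath α β)).sub (hψ.comp (by fun_prop))

lemma continuous_collA_section {ψ : Vel → ℝ} (hψ : Continuous ψ) (ζ : ℝ) (v w : Vel) :
    Continuous fun σ => ψ (postV ζ v w σ) + ψ (postW ζ v w σ) - ψ v - ψ w := by
  have h1 : Continuous fun σ => postV ζ v w σ := by unfold postV; fun_prop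
  have h2 : Continuous fun σ => postW ζ v w σ := by unfold postW; fun_prop
  fun_prop

lemma continuous_collJ_section {ψ : Vel → ℝ} (hψ : Continuous ψ) (α β : ℝ) (v w : Vel) :
    Continuous fun σ => ψ (postBath α β v w σ) - ψ v := by
  have h1 : Continuous fun σ => postBath α β v w σ := by unfold postBath; fun_prop
  fun_prop

/-- A Povzner-type bound without angular averaging: superadditivity and energy dissipation bound the
integrand by `φ(|v|²+|w|²) - φ(|v|²) - φ(|w|²)`, whose leading parts cancel. In the result one
variable carries only the energy, and the other loses the power of `|v|` gained from `|q|`. At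
velocity zero the quotient is `0`, which is harmless since `φ 0 = 0`. -/
lemma collA_le {r ζ : ℝ} {φ : ℝ → ℝ} (hr : 1 ≤ r) (h : IsPowerLike r φ) (h0 : 0 ≤ ζ)
    (h1 : ζ ≤ 1) (v w : Vel) :
    ‖v - w‖ * collA ζ (fun v => φ (‖v‖ ^ 2)) v w ≤
      2 ^ (r + 1) * (φ (‖v‖ ^ 2) / ‖v‖ * ‖w‖ ^ 2 + ‖v‖ ^ 2 * (φ (‖w‖ ^ 2) / ‖w‖)) := by
  have hA : collA ζ (fun v => φ (‖v‖ ^ 2)) v w ≤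
      φ (‖v‖ ^ 2 + ‖w‖ ^ 2) - φ (‖v‖ ^ 2) - φ (‖w‖ ^ 2) := by
    refine sphereAvg_le ?_ fun σ hσ => ?_
    · exact continuous_collA_section (continuous_comp_norm_sq h) ζ v w
    · have h2 := h.superadd (sq_nonneg ‖postV ζ v w σ‖) (sq_nonneg ‖postW ζ v w σ‖)
      have h3 := h.mono (by positivity) (norm_sq_postV_add_postW_le h0 h1 v w σ hσ)
      linarith
  have key : ∀ x y : ℝ, 0 ≤ x → 0 ≤ y → y ≤ x →
      (x + y) * (φ (x ^ 2 + y ^ 2) - φ (x ^ 2) - φ (y ^ 2)) ≤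
        2 ^ (r + 1) * (φ (x ^ 2) / x * y ^ 2) := by
    intro x y hx hy hyx
    have hφy := h.nonneg (y ^ 2) (sq_nonneg _)
    rcases hx.eq_or_lt with rfl | hx
    · have : y = 0 := le_antisymm hyx hy
      simp [this]
    have h2 := h.map_add_le hr (x := x ^ 2) (y := y ^ 2) (by positivity) (by positivity)
      (by gcongr)
    have hφx := h.nonneg (x ^ 2) (sq_nonneg _)
    have h4 : 0 ≤ 2 ^ r * (y ^ 2 / x ^ 2) * φ (x ^ 2) := by positivity
    calc (x + y) * (φ (x ^ 2 + y ^ 2) - φ (x ^ 2) - φ (y ^ 2))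
        ≤ (x + y) * (2 ^ r * (y ^ 2 / x ^ 2) * φ (x ^ 2)) := by
          refine mul_le_mul_of_nonneg_left ?_ (by linarith)
          linarith
      _ ≤ (2 * x) * (2 ^ r * (y ^ 2 / x ^ 2) * φ (x ^ 2)) :=
          mul_le_mul_of_nonneg_right (by linarith) h4
      _ = 2 ^ (r + 1) * (φ (x ^ 2) / x * y ^ 2) := by
          rw [Real.rpow_add_one (by norm_num)]
          field_simp
  have hq : ‖v - w‖ ≤ ‖v‖ + ‖w‖ := norm_sub_le v w
  have hφv := h.nonneg (‖v‖ ^ 2) (sq_nonneg _)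
  have hφw := h.nonneg (‖w‖ ^ 2) (sq_nonneg _)
  have hs := h.superadd (sq_nonneg ‖v‖) (sq_nonneg ‖w‖)
  have hv : 0 ≤ φ (‖v‖ ^ 2) / ‖v‖ * ‖w‖ ^ 2 := by positivity
  have hw : 0 ≤ ‖v‖ ^ 2 * (φ (‖w‖ ^ 2) / ‖w‖) := by positivity
  have h2r : (0 : ℝ) < 2 ^ (r + 1) := by positivity
  have hstep : ‖v - w‖ * collA ζ (fun v => φ (‖v‖ ^ 2)) v w ≤
      (‖v‖ + ‖w‖) * (φ (‖v‖ ^ 2 + ‖w‖ ^ 2) - φ (‖v‖ ^ 2) - φ (‖w‖ ^ 2)) :=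
    (mul_le_mul_of_nonneg_left hA (norm_nonneg _)).trans
      (mul_le_mul_of_nonneg_right hq (by linarith))
  rcases le_total ‖w‖ ‖v‖ with hvw | hvw
  · refine hstep.trans ((key _ _ (norm_nonneg _) (norm_nonneg _) hvw).trans ?_)
    gcongr; linarith
  · have := key _ _ (norm_nonneg _) (norm_nonneg _) hvw
    rw [add_comm ‖w‖, add_comm (‖w‖ ^ 2)] at this
    refine hstep.trans (le_trans (le_of_eq (by ring)) (this.trans ?_))
    gcongr
    linarith

/-- For exponent `1`, `star` and `dilate` are opposite inequalities, so the class contains only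
linear functions. -/
lemma IsPowerLike.eq_mul {φ : ℝ → ℝ} (h : IsPowerLike 1 φ) {x : ℝ} (hx : 0 ≤ x) :
    φ x = φ 1 * x := by
  rcases hx.eq_or_lt with rfl | hx
  · rw [h.map_zero, mul_zero]
  have hi : x⁻¹ * x = 1 := inv_mul_cancel₀ hx.ne'
  rcases le_total x 1 with h1 | h1
  · have e1 := h.star x 1 hx.le h1 zero_le_one
    have e2 := h.dilate x⁻¹ x ((one_le_inv₀ hx).2 h1) hx.le
    rw [hi, Real.rpow_one, ← div_eq_inv_mul, le_div_iff₀ hx] at e2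
    rw [mul_one] at e1
    linarith
  · have e1 := h.dilate x 1 h1 zero_le_one
    have e2 := h.star x⁻¹ x (by positivity) (inv_le_one_of_one_le₀ h1) hx.le
    rw [hi, ← div_eq_inv_mul, le_div_iff₀ hx] at e2
    rw [mul_one, Real.rpow_one] at e1
    linarith

/-- Granular collisions dissipate energy. -/
lemma collA_nonpos {ζ : ℝ} {φ : ℝ → ℝ} (h : IsPowerLike 1 φ) (h0 : 0 ≤ ζ) (h1 : ζ ≤ 1)
    (v w : Vel) : collA ζ (fun v => φ (‖v‖ ^ 2)) v w ≤ 0 := by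
  refine sphereAvg_le (continuous_collA_section (continuous_comp_norm_sq h) ζ v w)
    fun σ hσ => ?_
  have := mul_le_mul_of_nonneg_left (norm_sq_postV_add_postW_le h0 h1 v w σ hσ)
    (h.nonneg 1 zero_le_one)
  rw [h.eq_mul (sq_nonneg _), h.eq_mul (sq_nonneg ‖postW ζ v w σ‖), h.eq_mul (sq_nonneg ‖v‖),
    h.eq_mul (sq_nonneg ‖w‖)]
  linarith

/-- Half of the gain `2κ(1-κ)` is given up to absorb the perturbation by `w`; continuity at `η = 0`
suffices. -/
lemma exists_one_add_rpow_mul_le {r κ : ℝ} (h0 : 0 < κ) (h1 : κ < 1) :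
    ∃ η : ℝ, 0 < η ∧ (1 + η) ^ (2 * r) * (1 - 2 * κ * (1 - κ)) ≤ 1 - κ * (1 - κ) := by
  have hk : 0 < κ * (1 - κ) := mul_pos h0 (by linarith)
  have hc : ContinuousAt (fun η : ℝ => (1 + η) ^ (2 * r) * (1 - 2 * κ * (1 - κ))) 0 := by
    refine ContinuousAt.mul (ContinuousAt.rpow_const (by fun_prop) ?_) continuousAt_const
    left; norm_num
  have : ∀ᶠ η in 𝓝 (0 : ℝ), (1 + η) ^ (2 * r) * (1 - 2 * κ * (1 - κ)) < 1 - κ * (1 - κ) := by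
    refine hc.eventually_lt_const ?_
    simp; nlinarith
  obtain ⟨η, h2, h3⟩ := ((this.filter_mono nhdsWithin_le_nhds).and
    (self_mem_nhdsWithin : Ioi (0 : ℝ) ∈ 𝓝[>] 0)).exists
  exact ⟨η, h3, h2.le⟩

lemma norm_postBath_le {α β : ℝ} (h0 : 0 ≤ α * (1 - β)) (h1 : α * (1 - β) ≤ 1) (v w σ : Vel)
    (hσ : ‖σ‖ = 1) : ‖postBath α β v w σ‖ ≤
      ‖(1 - α * (1 - β)) • v + (α * (1 - β) * ‖v‖) • σ‖ + 2 * ‖w‖ := by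
  set κ := α * (1 - β)
  have : postBath α β v w σ =
      ((1 - κ) • v + (κ * ‖v‖) • σ) + (κ • w + (κ * (‖v - w‖ - ‖v‖)) • σ) := by
    rw [postBath]
    module
  rw [this]
  refine (norm_add_le _ _).trans (add_le_add le_rfl ((norm_add_le _ _).trans ?_))
  rw [norm_smul, norm_smul, hσ, Real.norm_of_nonneg h0, norm_mul, Real.norm_of_nonneg h0,
    Real.norm_eq_abs]
  have h2 : |‖v - w‖ - ‖v‖| ≤ ‖w‖ := by
    refine (abs_norm_sub_norm_le _ _).trans ?_
    simp
  nlinarith [norm_nonneg w, mul_le_mul h1 h2 (abs_nonneg _) zero_le_one]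

/-- The source of the damping. The constant `c` is chosen before `φ`, hence is the same for all
truncation levels. -/
lemma exists_collJ_le {r α β : ℝ} (hr : 1 ≤ r) (h0 : 0 < α * (1 - β)) (h1 : α * (1 - β) < 1) :
    ∃ c : ℝ, 0 < c ∧ ∀ φ, IsPowerLike r φ → ∀ v w : Vel,
      collJ α β (fun v => φ (‖v‖ ^ 2)) v w ≤
        -(α * (1 - β) * (1 - α * (1 - β))) * φ (‖v‖ ^ 2) + c * ‖w‖ ^ (2 * r) := by
  obtain ⟨η, hη, hη'⟩ := exists_one_add_rpow_mul_le (r := r) h0 h1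
  set κ := α * (1 - β) with hκ
  refine ⟨(1 + 1 / η) ^ (2 * r) * 2 ^ (2 * r), by positivity, fun φ h v w => ?_⟩
  set c := (1 + 1 / η) ^ (2 * r) * 2 ^ (2 * r) with hc
  have hsq : ∀ x : ℝ, 0 ≤ x → (x ^ 2) ^ r = x ^ (2 * r) := fun x hx => by
    rw [Real.rpow_mul hx, Real.rpow_two]
  have hφv := h.nonneg (‖v‖ ^ 2) (sq_nonneg _)
  -- the bound for fixed `σ`
  have hσ : ∀ σ : Vel, ‖σ‖ = 1 → φ (‖postBath α β v w σ‖ ^ 2) - φ (‖v‖ ^ 2) ≤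
      ((1 + η) ^ (2 * r) * (1 - 2 * κ * (1 - κ)) - 1) * φ (‖v‖ ^ 2) + c * ‖w‖ ^ (2 * r) +
      (1 + η) ^ (2 * r) * (2 * κ * (1 - κ)) * φ (‖v‖ ^ 2) / ‖v‖ * inner ℝ v σ := by
    intro σ hσ
    set a := (1 - κ) • v + (κ * ‖v‖) • σ with ha
    have hpost := norm_postBath_le h0.le h1.le v w σ hσ
    rw [← hκ, ← ha] at hpost
    have h3 : φ (‖postBath α β v w σ‖ ^ 2) ≤
        (1 + η) ^ (2 * r) * φ (‖a‖ ^ 2) + c * ‖w‖ ^ (2 * r) := by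
      have hφa := h.nonneg (‖a‖ ^ 2) (sq_nonneg _)
      -- Either `w` perturbs `a` by a factor at most `1 + η`, or the whole post-collisional velocity
      -- is controlled by `|w|`.
      rcases le_total (2 * ‖w‖) (η * ‖a‖) with hcase | hcase
      · have : ‖postBath α β v w σ‖ ^ 2 ≤ (1 + η) ^ 2 * ‖a‖ ^ 2 := by
          rw [← mul_pow]; gcongr; linarith
        have h4 := (h.mono (by positivity) this).trans
          (h.dilate ((1 + η) ^ 2) (‖a‖ ^ 2) (by nlinarith) (by positivity))
        rw [hsq _ (by positivity)] at h4
        have : 0 ≤ c * ‖w‖ ^ (2 * r) := by positivity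
        linarith
      · have hle : ‖postBath α β v w σ‖ ≤ (1 + 1 / η) * (2 * ‖w‖) := by
          have : ‖a‖ ≤ 1 / η * (2 * ‖w‖) := by
            rw [one_div, ← div_eq_inv_mul, le_div_iff₀ hη]; linarith
          linarith
        have h4 := h.le_rpow _ (sq_nonneg ‖postBath α β v w σ‖)
        rw [hsq _ (norm_nonneg _)] at h4
        have h5 := Real.rpow_le_rpow (norm_nonneg _) hle (by linarith : 0 ≤ 2 * r)
        rw [Real.mul_rpow (by positivity) (by positivity),
          Real.mul_rpow (by positivity) (by positivity), ← mul_assoc, ← hc] at h5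
        have : 0 ≤ (1 + η) ^ (2 * r) * φ (‖a‖ ^ 2) := by positivity
        linarith
    -- Star-shapedness with the ratio `|a|²/|v|² ≤ 1` gives a bound that is affine in `v·σ`, so its
    -- average can be computed.
    have h6 : φ (‖a‖ ^ 2) ≤ (1 - 2 * κ * (1 - κ)) * φ (‖v‖ ^ 2) +
        2 * κ * (1 - κ) * φ (‖v‖ ^ 2) / ‖v‖ * inner ℝ v σ := by
      have hna : ‖a‖ ^ 2 = (1 - 2 * κ * (1 - κ)) * ‖v‖ ^ 2 +
          2 * κ * (1 - κ) * ‖v‖ * inner ℝ v σ := by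
        rw [ha, norm_add_sq_real, norm_smul, norm_smul, real_inner_smul_left,
          real_inner_smul_right, hσ]
        simp only [mul_pow, norm_mul, Real.norm_eq_abs, sq_abs]
        ring
      rcases (norm_nonneg v).eq_or_lt with hv | hv
      · rw [hna, ← hv]; simp [h.map_zero]
      · have hle : ‖a‖ ^ 2 / ‖v‖ ^ 2 ≤ 1 := by
          refine div_le_one_of_le₀ ?_ (by positivity)
          have h7 : inner ℝ v σ ≤ ‖v‖ := by simpa [hσ] using real_inner_le_norm v σ
          have h8 : 0 ≤ 2 * κ * (1 - κ) * ‖v‖ := by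
            have : 0 < 1 - κ := by linarith
            positivity
          nlinarith [mul_le_mul_of_nonneg_left h7 h8]
        have := h.star _ (‖v‖ ^ 2) (by positivity) hle (by positivity)
        rw [div_mul_cancel₀ _ (by positivity)] at this
        refine this.trans_eq ?_
        rw [hna]
        field_simp
    have h9 := mul_le_mul_of_nonneg_left h6 (by positivity : 0 ≤ (1 + η) ^ (2 * r))
    have h10 : (1 + η) ^ (2 * r) * (2 * κ * (1 - κ)) * φ (‖v‖ ^ 2) / ‖v‖ * inner ℝ v σ =
      (1 + η) ^ (2 * r) * (2 * κ * (1 - κ) * φ (‖v‖ ^ 2) / ‖v‖ * inner ℝ v σ) := by ring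
    rw [h10]
    linarith
  have hcont : Continuous fun σ : Vel => φ (‖postBath α β v w σ‖ ^ 2) - φ (‖v‖ ^ 2) :=
    continuous_collJ_section (continuous_comp_norm_sq h) α β v w
  refine (sphereAvg_mono hcont (by fun_prop) hσ).trans ?_
  rw [sphereAvg_eq, integral_add (integrable_const _)
    (integrable_sphere (g := fun σ => _ * inner ℝ v σ) (by fun_prop)), integral_const_mul,
    integral_inner_sphere]
  simp only [integral_const, probReal_univ, smul_eq_mul, one_mul, mul_zero, add_zero]
  have := mul_le_mul_of_nonneg_right hη' hφv
  linarith

/-! ### Polynomial weights and growth of the collision kernels -/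

/-- The polynomial weight `(1 + |v|) ^ N`. -/
noncomputable def wt (N : ℕ) (v : Vel) : ℝ := (1 + ‖v‖) ^ N

lemma wt_pos (N : ℕ) (v : Vel) : 0 < wt N v := by unfold wt; positivity

lemma one_le_wt (N : ℕ) (v : Vel) : 1 ≤ wt N v := one_le_pow₀ (by simp)

lemma continuous_wt (N : ℕ) : Continuous (wt N) := by unfold wt; fun_prop

lemma wt_mono {M N : ℕ} (h : M ≤ N) (v : Vel) : wt M v ≤ wt N v :=
  pow_le_pow_right₀ (by simp) h

lemma wt_succ (N : ℕ) (v : Vel) : wt (N + 1) v = wt N v * (1 + ‖v‖) := pow_succ _ _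

/-- The coefficients `3` and `2` are large enough for all three post-collisional velocities and for
`v`, `w` themselves. -/
lemma wt_le_of_norm_le (N : ℕ) {u v w : Vel} (h : ‖u‖ ≤ 3 * ‖v‖ + 2 * ‖w‖) :
    wt N u ≤ 3 ^ N * (wt N v * wt N w) := by
  unfold wt
  rw [← mul_pow, ← mul_pow]
  gcongr
  nlinarith [norm_nonneg v, norm_nonneg w, mul_nonneg (norm_nonneg v) (norm_nonneg w)]

lemma norm_sub_mul_wt_le (N : ℕ) (v w : Vel) :
    ‖v - w‖ * (wt N v * wt N w) ≤ wt (N + 1) v * wt (N + 1) w := by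
  have h : ‖v - w‖ ≤ (1 + ‖v‖) * (1 + ‖w‖) := by
    nlinarith [norm_sub_le v w, norm_nonneg v, norm_nonneg w,
      mul_nonneg (norm_nonneg v) (norm_nonneg w)]
  have := mul_le_mul_of_nonneg_right h (mul_pos (wt_pos N v) (wt_pos N w)).le
  rw [wt_succ, wt_succ]
  linarith

lemma norm_postV_le {ζ : ℝ} (h0 : 0 ≤ ζ) (h1 : ζ ≤ 1) (v w σ : Vel) (hσ : ‖σ‖ = 1) :
    ‖postV ζ v w σ‖ ≤ 2 * ‖v‖ + ‖w‖ := by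
  have h2 : ‖‖v - w‖ • σ - (v - w)‖ ≤ 2 * ‖v - w‖ := by
    refine (norm_sub_le _ _).trans ?_
    rw [norm_smul, hσ]; simp; linarith
  have h3 : ‖(ζ / 2) • (‖v - w‖ • σ - (v - w))‖ ≤ ‖v - w‖ := by
    rw [norm_smul, Real.norm_of_nonneg (by linarith)]
    nlinarith [norm_nonneg (v - w), norm_nonneg (‖v - w‖ • σ - (v - w))]
  refine (norm_add_le _ _).trans ?_
  linarith [norm_sub_le v w]

lemma norm_postW_le {ζ : ℝ} (h0 : 0 ≤ ζ) (h1 : ζ ≤ 1) (v w σ : Vel) (hσ : ‖σ‖ = 1) :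
    ‖postW ζ v w σ‖ ≤ ‖v‖ + 2 * ‖w‖ := by
  have h2 : ‖‖v - w‖ • σ - (v - w)‖ ≤ 2 * ‖v - w‖ := by
    refine (norm_sub_le _ _).trans ?_
    rw [norm_smul, hσ]; simp; linarith
  have h3 : ‖(ζ / 2) • (‖v - w‖ • σ - (v - w))‖ ≤ ‖v - w‖ := by
    rw [norm_smul, Real.norm_of_nonneg (by linarith)]
    nlinarith [norm_nonneg (v - w), norm_nonneg (‖v - w‖ • σ - (v - w))]
  refine (norm_sub_le _ _).trans ?_
  linarith [norm_sub_le v w]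

lemma norm_postBath_le' {α β : ℝ} (h0 : 0 ≤ α * (1 - β)) (h1 : α * (1 - β) ≤ 1) (v w σ : Vel)
    (hσ : ‖σ‖ = 1) : ‖postBath α β v w σ‖ ≤ 3 * ‖v‖ + 2 * ‖w‖ := by
  have h2 : ‖(v - w) - ‖v - w‖ • σ‖ ≤ 2 * ‖v - w‖ := by
    refine (norm_sub_le _ _).trans ?_
    rw [norm_smul, hσ]; simp; linarith
  have h3 : ‖(α * (1 - β)) • ((v - w) - ‖v - w‖ • σ)‖ ≤ 2 * ‖v - w‖ := by
    rw [norm_smul, Real.norm_of_nonneg h0]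
    nlinarith [norm_nonneg (v - w), norm_nonneg ((v - w) - ‖v - w‖ • σ)]
  refine (norm_sub_le _ _).trans ?_
  linarith [norm_sub_le v w]

/-- The kernel `|q| 𝒜_ζ[ψ](v,w)`. -/
noncomputable def kerA (ζ : ℝ) (ψ : Vel → ℝ) (v w : Vel) : ℝ := ‖v - w‖ * collA ζ ψ v w

/-- The kernel `|q| 𝒥_e[ψ](v,w)`. -/
noncomputable def kerJ (α β : ℝ) (ψ : Vel → ℝ) (v w : Vel) : ℝ := ‖v - w‖ * collJ α β ψ v w

section growth
variable {ζ α β c : ℝ} {N : ℕ} {ψ : Vel → ℝ}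

lemma abs_comp_le_of_norm_le (hc : 0 ≤ c) (hψ : ∀ v, |ψ v| ≤ c * wt N v) {u v w : Vel}
    (h : ‖u‖ ≤ 3 * ‖v‖ + 2 * ‖w‖) : |ψ u| ≤ c * (3 ^ N * (wt N v * wt N w)) :=
  (hψ u).trans (mul_le_mul_of_nonneg_left (wt_le_of_norm_le N h) hc)

lemma abs_collA_integrand_le (h0 : 0 ≤ ζ) (h1 : ζ ≤ 1) (hc : 0 ≤ c)
    (hψ : ∀ v, |ψ v| ≤ c * wt N v) (v w σ : Vel) (hσ : ‖σ‖ = 1) :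
    |ψ (postV ζ v w σ) + ψ (postW ζ v w σ) - ψ v - ψ w| ≤
      4 * 3 ^ N * c * (wt N v * wt N w) := by
  have hv := norm_nonneg v
  have hw := norm_nonneg w
  have a1 := abs_comp_le_of_norm_le hc hψ (u := postV ζ v w σ) (v := v) (w := w)
    (by linarith [norm_postV_le h0 h1 v w σ hσ])
  have a2 := abs_comp_le_of_norm_le hc hψ (u := postW ζ v w σ) (v := v) (w := w)
    (by linarith [norm_postW_le h0 h1 v w σ hσ])
  have a3 := abs_comp_le_of_norm_le hc hψ (u := v) (v := v) (w := w) (by linarith)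
  have a4 := abs_comp_le_of_norm_le hc hψ (u := w) (v := v) (w := w) (by linarith)
  rw [abs_le] at *
  constructor <;> linarith

lemma abs_collJ_integrand_le (h0 : 0 ≤ α * (1 - β)) (h1 : α * (1 - β) ≤ 1) (hc : 0 ≤ c)
    (hψ : ∀ v, |ψ v| ≤ c * wt N v) (v w σ : Vel) (hσ : ‖σ‖ = 1) :
    |ψ (postBath α β v w σ) - ψ v| ≤ 4 * 3 ^ N * c * (wt N v * wt N w) := by
  have hv := norm_nonneg v
  have hw := norm_nonneg w
  have a1 := abs_comp_le_of_norm_le hc hψ (norm_postBath_le' h0 h1 v w σ hσ)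
  have a3 := abs_comp_le_of_norm_le hc hψ (u := v) (v := v) (w := w) (by linarith)
  have : 0 ≤ c * (3 ^ N * (wt N v * wt N w)) := (abs_nonneg _).trans a1
  rw [abs_le] at *
  constructor <;> linarith

lemma abs_norm_sub_mul_le {x C : ℝ} {v w : Vel} (hC : 0 ≤ C)
    (h : |x| ≤ C * (wt N v * wt N w)) :
    |‖v - w‖ * x| ≤ C * (wt (N + 1) v * wt (N + 1) w) := by
  rw [abs_mul, abs_norm]
  have h1 := mul_le_mul_of_nonneg_left h (norm_nonneg (v - w))
  have h2 := mul_le_mul_of_nonneg_left (norm_sub_mul_wt_le N v w) hC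
  linarith

lemma abs_kerA_le (h0 : 0 ≤ ζ) (h1 : ζ ≤ 1) (hc : 0 ≤ c)
    (hψ : ∀ v, |ψ v| ≤ c * wt N v) (v w : Vel) :
    |kerA ζ ψ v w| ≤ 4 * 3 ^ N * c * (wt (N + 1) v * wt (N + 1) w) :=
  abs_norm_sub_mul_le (by positivity)
    (abs_sphereAvg_le (abs_collA_integrand_le h0 h1 hc hψ v w))

lemma abs_kerJ_le (h0 : 0 ≤ α * (1 - β)) (h1 : α * (1 - β) ≤ 1) (hc : 0 ≤ c)
    (hψ : ∀ v, |ψ v| ≤ c * wt N v) (v w : Vel) :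
    |kerJ α β ψ v w| ≤ 4 * 3 ^ N * c * (wt (N + 1) v * wt (N + 1) w) :=
  abs_norm_sub_mul_le (by positivity)
    (abs_sphereAvg_le (abs_collJ_integrand_le h0 h1 hc hψ v w))

lemma stronglyMeasurable_kerA (hψ : Continuous ψ) (ζ : ℝ) :
    StronglyMeasurable fun p : Vel × Vel => kerA ζ ψ p.1 p.2 := by
  have h := stronglyMeasurable_sphereAvg (continuous_collA_integrand hψ ζ)
  have hc : Continuous fun p : Vel × Vel => ‖p.1 - p.2‖ := by fun_prop
  exact hc.stronglyMeasurable.mul h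

lemma stronglyMeasurable_kerJ (hψ : Continuous ψ) (α β : ℝ) :
    StronglyMeasurable fun p : Vel × Vel => kerJ α β ψ p.1 p.2 := by
  have h := stronglyMeasurable_sphereAvg (continuous_collJ_integrand hψ α β)
  have hc : Continuous fun p : Vel × Vel => ‖p.1 - p.2‖ := by fun_prop
  exact hc.stronglyMeasurable.mul h

lemma tendsto_kerA {ψs : ℕ → Vel → ℝ} (hcont : ∀ n, Continuous (ψs n)) (h0 : 0 ≤ ζ)
    (h1 : ζ ≤ 1) (hc : 0 ≤ c) (hψ : ∀ n v, |ψs n v| ≤ c * wt N v)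
    (H : ∀ v, Tendsto (fun n => ψs n v) atTop (𝓝 (ψ v))) (v w : Vel) :
    Tendsto (fun n => kerA ζ (ψs n) v w) atTop (𝓝 (kerA ζ ψ v w)) := by
  refine Tendsto.const_mul _ (tendsto_sphereAvg
    (fun n => continuous_collA_section (hcont n) ζ v w) (4 * 3 ^ N * c * (wt N v * wt N w))
    (fun n σ hσ => abs_collA_integrand_le h0 h1 hc (hψ n) v w σ hσ) fun σ _ => ?_)
  exact (((H _).add (H _)).sub (H _)).sub (H _)

lemma tendsto_kerJ {ψs : ℕ → Vel → ℝ} (hcont : ∀ n, Continuous (ψs n))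
    (h0 : 0 ≤ α * (1 - β)) (h1 : α * (1 - β) ≤ 1) (hc : 0 ≤ c)
    (hψ : ∀ n v, |ψs n v| ≤ c * wt N v)
    (H : ∀ v, Tendsto (fun n => ψs n v) atTop (𝓝 (ψ v))) (v w : Vel) :
    Tendsto (fun n => kerJ α β (ψs n) v w) atTop (𝓝 (kerJ α β ψ v w)) := by
  refine Tendsto.const_mul _ (tendsto_sphereAvg
    (fun n => continuous_collJ_section (hcont n) α β v w) (4 * 3 ^ N * c * (wt N v * wt N w))
    (fun n σ hσ => abs_collJ_integrand_le h0 h1 hc (hψ n) v w σ hσ) fun σ _ => ?_)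
  exact (H _).sub (H _)

end growth

/-! ### Bilinear forms in weighted spaces -/

/-- The bilinear form `∬ f(v) g(w) G(v,w) dw dv`. -/
noncomputable def bil (G : Vel → Vel → ℝ) (f g : Vel → ℝ) : ℝ := ∫ v, ∫ w, f v * g w * G v w

lemma weakQ_eq (ε : ℝ) (f ψ : Vel → ℝ) :
    weakQ ε f ψ = (1 / 2) * bil (kerA ((1 + ε) / 2) ψ) f f := by
  simp only [weakQ, bil, kerA, mul_assoc]

lemma weakL_eq (α β lam : ℝ) (F₁ f ψ : Vel → ℝ) :
    weakL α β lam F₁ f ψ = (1 / lam) * bil (kerJ α β ψ) f F₁ := by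
  simp only [weakL, bil, kerJ]
  congr! 5
  ring

/-- Integrability against the weight `(1 + |v|) ^ N`. -/
def WInt (N : ℕ) (f : Vel → ℝ) : Prop := Integrable fun v => f v * wt N v

lemma WInt.aestronglyMeasurable {N : ℕ} {f : Vel → ℝ} (h : WInt N f) :
    AEStronglyMeasurable f := by
  have h2 : Continuous fun v => (wt N v)⁻¹ :=
    (continuous_wt N).inv₀ fun v => (wt_pos N v).ne'
  refine (Integrable.aestronglyMeasurable h |>.mul h2.aestronglyMeasurable).congr
    (.of_forall fun v => ?_)
  simp [(wt_pos N v).ne']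

lemma WInt.mul {N : ℕ} {f : Vel → ℝ} (h : WInt N f) {ψ : Vel → ℝ} {c : ℝ}
    (hm : AEStronglyMeasurable ψ) (hψ : ∀ v, |ψ v| ≤ c * wt N v) :
    Integrable fun v => f v * ψ v := by
  refine (h.norm.const_mul c).mono' (h.aestronglyMeasurable.mul hm) (.of_forall fun v => ?_)
  rw [norm_mul, norm_mul, Real.norm_of_nonneg (wt_pos N v).le]
  have := mul_le_mul_of_nonneg_left (hψ v) (norm_nonneg (f v))
  rw [Real.norm_eq_abs (ψ v)]
  linarith

lemma WInt.mono {M N : ℕ} {f : Vel → ℝ} (h : WInt N f) (hMN : M ≤ N) : WInt M f :=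
  h.mul (c := 1) (continuous_wt M).aestronglyMeasurable fun v => by
    rw [abs_of_pos (wt_pos M v), one_mul]; exact wt_mono hMN v

lemma WInt.sub {N : ℕ} {f g : Vel → ℝ} (hf : WInt N f) (hg : WInt N g) :
    WInt N fun v => f v - g v := by
  simp only [WInt, sub_mul]
  exact Integrable.sub hf hg

lemma WInt.abs {N : ℕ} {f : Vel → ℝ} (hf : WInt N f) : WInt N fun v => |f v| := by
  refine (Integrable.norm hf).congr (.of_forall fun v => ?_)
  simp [abs_of_pos (wt_pos N v)]

lemma integrable_bil {N M : ℕ} {f g : Vel → ℝ} (hf : WInt N f) (hg : WInt M g)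
    {G : Vel → Vel → ℝ} {c : ℝ} (hG : StronglyMeasurable fun p : Vel × Vel => G p.1 p.2)
    (hc : ∀ v w, |G v w| ≤ c * (wt N v * wt M w)) :
    Integrable (fun p : Vel × Vel => f p.1 * g p.2 * G p.1 p.2)
      ((volume : Measure Vel).prod volume) := by
  refine ((Integrable.mul_prod hf hg).norm.const_mul c).mono'
    ((hf.aestronglyMeasurable.comp_fst.mul hg.aestronglyMeasurable.comp_snd).mul
      hG.aestronglyMeasurable) (.of_forall fun p => ?_)
  simp only [norm_mul, Real.norm_eq_abs, abs_of_pos (wt_pos _ _)]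
  have := mul_le_mul_of_nonneg_left (hc p.1 p.2)
    (mul_nonneg (abs_nonneg (f p.1)) (abs_nonneg (g p.2)))
  linarith

lemma bil_eq_integral_prod {N M : ℕ} {f g : Vel → ℝ} (hf : WInt N f) (hg : WInt M g)
    {G : Vel → Vel → ℝ} {c : ℝ} (hG : StronglyMeasurable fun p : Vel × Vel => G p.1 p.2)
    (hc : ∀ v w, |G v w| ≤ c * (wt N v * wt M w)) :
    bil G f g = ∫ p : Vel × Vel, f p.1 * g p.2 * G p.1 p.2 ∂(volume.prod volume) :=
  (integral_prod _ (integrable_bil hf hg hG hc)).symm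

lemma abs_bil_le {N M : ℕ} {f g : Vel → ℝ} (hf : WInt N f) (hg : WInt M g)
    {G : Vel → Vel → ℝ} {c : ℝ} (hG : StronglyMeasurable fun p : Vel × Vel => G p.1 p.2)
    (hc : ∀ v w, |G v w| ≤ c * (wt N v * wt M w)) :
    |bil G f g| ≤ c * ((∫ v, |f v| * wt N v) * ∫ v, |g v| * wt M v) := by
  rw [bil_eq_integral_prod hf hg hG hc, ← integral_prod_mul, ← integral_const_mul,
    ← Real.norm_eq_abs]
  refine norm_integral_le_of_norm_le ((Integrable.mul_prod hf.abs hg.abs).const_mul c)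
    (.of_forall fun p => ?_)
  simp only [norm_mul, Real.norm_eq_abs]
  have := mul_le_mul_of_nonneg_left (hc p.1 p.2)
    (mul_nonneg (abs_nonneg (f p.1)) (abs_nonneg (g p.2)))
  linarith

lemma bil_sub_bil {N M : ℕ} {f g f' g' : Vel → ℝ} (hf : WInt N f) (hg : WInt M g)
    (hf' : WInt N f') (hg' : WInt M g')
    {G : Vel → Vel → ℝ} {c : ℝ} (hG : StronglyMeasurable fun p : Vel × Vel => G p.1 p.2)
    (hc : ∀ v w, |G v w| ≤ c * (wt N v * wt M w)) :
    bil G f g - bil G f' g' =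
      bil G (fun v => f v - f' v) g + bil G f' (fun v => g v - g' v) := by
  rw [bil_eq_integral_prod hf hg hG hc, bil_eq_integral_prod hf' hg' hG hc,
    bil_eq_integral_prod (hf.sub hf') hg hG hc, bil_eq_integral_prod hf' (hg.sub hg') hG hc,
    ← integral_sub (integrable_bil hf hg hG hc) (integrable_bil hf' hg' hG hc),
    ← integral_add (integrable_bil (hf.sub hf') hg hG hc)
      (integrable_bil hf' (hg.sub hg') hG hc)]
  congr 1
  ext p
  ring

lemma tendsto_bil {ι : Type*} {l : Filter ι} {N M : ℕ} {fs gs : ι → Vel → ℝ} {f g : Vel → ℝ}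
    (hfs : ∀ᶠ i in l, WInt N (fs i)) (hgs : ∀ᶠ i in l, WInt M (gs i)) (hf : WInt N f)
    (hg : WInt M g) (hlf : Tendsto (fun i => ∫ v, |fs i v - f v| * wt N v) l (𝓝 0))
    (hlg : Tendsto (fun i => ∫ v, |gs i v - g v| * wt M v) l (𝓝 0))
    {G : Vel → Vel → ℝ} {c : ℝ} (hG : StronglyMeasurable fun p : Vel × Vel => G p.1 p.2)
    (hc : ∀ v w, |G v w| ≤ c * (wt N v * wt M w)) :
    Tendsto (fun i => bil G (fs i) (gs i)) l (𝓝 (bil G f g)) := by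
  have hc0 : 0 ≤ c := by
    have := (abs_nonneg _).trans (hc 0 0)
    simpa [wt] using this
  rw [tendsto_iff_norm_sub_tendsto_zero]
  set a := fun i => ∫ v, |fs i v - f v| * wt N v
  set b := fun i => ∫ v, |gs i v - g v| * wt M v
  set A := ∫ v, |f v| * wt N v
  set B := ∫ v, |g v| * wt M v
  have hlim : Tendsto (fun i => c * (a i * (b i + B)) + c * (A * b i)) l (𝓝 0) := by
    have := ((hlf.mul (hlg.add_const B)).const_mul c).add ((hlg.const_mul A).const_mul c)
    simpa using this
  refine squeeze_zero' (.of_forall fun i => norm_nonneg _) ?_ hlim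
  filter_upwards [hfs, hgs] with i hfi hgi
  rw [bil_sub_bil hfi hgi hf hg hG hc]
  have ha0 : 0 ≤ a i := integral_nonneg fun v => mul_nonneg (abs_nonneg _) (wt_pos _ _).le
  have hgB : ∫ v, |gs i v| * wt M v ≤ b i + B := by
    rw [← integral_add (hgi.sub hg).abs hg.abs]
    refine integral_mono hgi.abs (Integrable.add (hgi.sub hg).abs hg.abs) fun v => ?_
    change |gs i v| * wt M v ≤ |gs i v - g v| * wt M v + |g v| * wt M v
    rw [← add_mul]
    refine mul_le_mul_of_nonneg_right ?_ (wt_pos M v).le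
    have := abs_add_le (gs i v - g v) (g v)
    simpa using this
  refine (norm_add_le _ _).trans (add_le_add ?_ (abs_bil_le hf (hgi.sub hg) hG hc))
  refine (abs_bil_le (hfi.sub hf) hgi hG hc).trans ?_
  gcongr

lemma tendsto_bil_kernel {N M : ℕ} {f g : Vel → ℝ} (hf : WInt N f) (hg : WInt M g)
    {Gs : ℕ → Vel → Vel → ℝ} {G : Vel → Vel → ℝ} {c : ℝ}
    (hG : ∀ n, StronglyMeasurable fun p : Vel × Vel => Gs n p.1 p.2)
    (hc : ∀ n v w, |Gs n v w| ≤ c * (wt N v * wt M w))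
    (H : ∀ v w, Tendsto (fun n => Gs n v w) atTop (𝓝 (G v w))) :
    Tendsto (fun n => bil (Gs n) f g) atTop (𝓝 (bil G f g)) := by
  have hGm : StronglyMeasurable fun p : Vel × Vel => G p.1 p.2 :=
    stronglyMeasurable_of_tendsto atTop hG (tendsto_pi_nhds.2 fun p => H p.1 p.2)
  have hcG : ∀ v w, |G v w| ≤ c * (wt N v * wt M w) := fun v w =>
    le_of_tendsto (H v w).abs (.of_forall fun n => hc n v w)
  rw [bil_eq_integral_prod hf hg hGm hcG]
  simp only [fun n => bil_eq_integral_prod hf hg (hG n) (hc n)]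
  refine tendsto_integral_of_dominated_convergence
    (fun p => c * (|f p.1| * wt N p.1 * (|g p.2| * wt M p.2)))
    (fun n => (integrable_bil hf hg (hG n) (hc n)).aestronglyMeasurable)
    ((Integrable.mul_prod hf.abs hg.abs).const_mul c) ?_ ?_
  · refine fun n => .of_forall fun p => ?_
    simp only [norm_mul, Real.norm_eq_abs]
    have := mul_le_mul_of_nonneg_left (hc n p.1 p.2)
      (mul_nonneg (abs_nonneg (f p.1)) (abs_nonneg (g p.2)))
    linarith
  · exact .of_forall fun p => (H p.1 p.2).const_mul _

/-- Measurable kernels bounded by a multiple of `(1 + |v|) ^ N (1 + |w|) ^ M`. -/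
structure IsKernel (N M : ℕ) (G : Vel → Vel → ℝ) : Prop where
  meas : StronglyMeasurable fun p : Vel × Vel => G p.1 p.2
  bound : ∃ c, ∀ v w, |G v w| ≤ c * (wt N v * wt M w)

/-- Measurable functions bounded by a multiple of `(1 + |v|) ^ N`. -/
structure HasGrowth (N : ℕ) (ψ : Vel → ℝ) : Prop where
  meas : StronglyMeasurable ψ
  bound : ∃ c, 0 ≤ c ∧ ∀ v, |ψ v| ≤ c * wt N v

lemma HasGrowth.mono {M N : ℕ} {ψ : Vel → ℝ} (h : HasGrowth M ψ) (hMN : M ≤ N) :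
    HasGrowth N ψ := by
  obtain ⟨c, hc, hb⟩ := h.bound
  exact ⟨h.meas, c, hc, fun v => (hb v).trans (mul_le_mul_of_nonneg_left (wt_mono hMN v) hc)⟩

lemma WInt.integrable {N : ℕ} {f ψ : Vel → ℝ} (h : WInt N f) (hψ : HasGrowth N ψ) :
    Integrable fun v => f v * ψ v := by
  obtain ⟨c, hc, hb⟩ := hψ.bound
  exact h.mul hψ.meas.aestronglyMeasurable hb

lemma HasGrowth.isKernel {N M : ℕ} {a b : Vel → ℝ} (ha : HasGrowth N a) (hb : HasGrowth M b) :
    IsKernel N M fun v w => a v * b w := by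
  obtain ⟨c, hc, hac⟩ := ha.bound
  obtain ⟨d, hd, hbd⟩ := hb.bound
  refine ⟨(ha.meas.comp_measurable measurable_fst).mul (hb.meas.comp_measurable measurable_snd),
    c * d, fun v w => ?_⟩
  rw [abs_mul]
  refine (mul_le_mul (hac v) (hbd w) (abs_nonneg _) ((abs_nonneg _).trans (hac v))).trans_eq ?_
  ring

lemma IsKernel.add {N M : ℕ} {G H : Vel → Vel → ℝ} (hG : IsKernel N M G)
    (hH : IsKernel N M H) : IsKernel N M fun v w => G v w + H v w := by
  obtain ⟨c, hc⟩ := hG.bound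
  obtain ⟨d, hd⟩ := hH.bound
  refine ⟨hG.meas.add hH.meas, c + d, fun v w => (abs_add_le _ _).trans ?_⟩
  rw [add_mul]
  exact add_le_add (hc v w) (hd v w)

lemma bil_add {N M : ℕ} {f g : Vel → ℝ} (hf : WInt N f) (hg : WInt M g)
    {G H : Vel → Vel → ℝ} (hG : IsKernel N M G) (hH : IsKernel N M H) :
    bil (fun v w => G v w + H v w) f g = bil G f g + bil H f g := by
  obtain ⟨e, he⟩ := (hG.add hH).bound
  obtain ⟨c, hc⟩ := hG.bound
  obtain ⟨d, hd⟩ := hH.bound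
  rw [bil_eq_integral_prod hf hg hG.meas hc, bil_eq_integral_prod hf hg hH.meas hd,
    bil_eq_integral_prod hf hg (hG.add hH).meas he,
    ← integral_add (integrable_bil hf hg hG.meas hc) (integrable_bil hf hg hH.meas hd)]
  congr 1
  ext p
  ring

lemma bil_mul (a b f g : Vel → ℝ) :
    bil (fun v w => a v * b w) f g = (∫ v, f v * a v) * ∫ w, g w * b w := by
  rw [bil, ← integral_mul_const]
  congr 1
  ext v
  rw [← integral_const_mul]
  congr 1
  ext w
  ring

lemma bil_mono {N M : ℕ} {f g : Vel → ℝ} (hf : WInt N f) (hg : WInt M g)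
    (hf0 : ∀ᵐ v, 0 ≤ f v) (hg0 : ∀ᵐ v, 0 ≤ g v)
    {G H : Vel → Vel → ℝ} (hG : IsKernel N M G) (hH : IsKernel N M H)
    (hGH : ∀ v w, G v w ≤ H v w) :
    bil G f g ≤ bil H f g := by
  obtain ⟨c, hc⟩ := hG.bound
  obtain ⟨d, hd⟩ := hH.bound
  rw [bil_eq_integral_prod hf hg hG.meas hc, bil_eq_integral_prod hf hg hH.meas hd]
  refine integral_mono_ae (integrable_bil hf hg hG.meas hc)
    (integrable_bil hf hg hH.meas hd) ?_
  have h1 : ∀ᵐ p : Vel × Vel ∂(volume.prod volume), 0 ≤ f p.1 :=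
    Measure.quasiMeasurePreserving_fst.ae hf0
  have h2 : ∀ᵐ p : Vel × Vel ∂(volume.prod volume), 0 ≤ g p.2 :=
    Measure.quasiMeasurePreserving_snd.ae hg0
  filter_upwards [h1, h2] with p hp1 hp2
  exact mul_le_mul_of_nonneg_left (hGH _ _) (mul_nonneg hp1 hp2)

lemma isKernel_kerA {ζ : ℝ} (h0 : 0 ≤ ζ) (h1 : ζ ≤ 1) {N : ℕ} {ψ : Vel → ℝ}
    (hψ : HasGrowth N ψ) (hcont : Continuous ψ) :
    IsKernel (N + 1) (N + 1) (kerA ζ ψ) := by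
  obtain ⟨c, hc, hb⟩ := hψ.bound
  exact ⟨stronglyMeasurable_kerA hcont ζ, _, abs_kerA_le h0 h1 hc hb⟩

lemma isKernel_kerJ {α β : ℝ} (h0 : 0 ≤ α * (1 - β)) (h1 : α * (1 - β) ≤ 1) {N : ℕ}
    {ψ : Vel → ℝ} (hψ : HasGrowth N ψ) (hcont : Continuous ψ) :
    IsKernel (N + 1) (N + 1) (kerJ α β ψ) := by
  obtain ⟨c, hc, hb⟩ := hψ.bound
  exact ⟨stronglyMeasurable_kerJ hcont α β, _, abs_kerJ_le h0 h1 hc hb⟩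

lemma IsKernel.mono {N M N' M' : ℕ} {G : Vel → Vel → ℝ} (h : IsKernel N M G) (hN : N ≤ N')
    (hM : M ≤ M') : IsKernel N' M' G := by
  obtain ⟨c, hc⟩ := h.bound
  have hc0 : 0 ≤ c := by
    have := (abs_nonneg _).trans (hc 0 0)
    simpa [wt] using this
  refine ⟨h.meas, c, fun v w => (hc v w).trans (mul_le_mul_of_nonneg_left ?_ hc0)⟩
  exact mul_le_mul (wt_mono hN v) (wt_mono hM w) (wt_pos _ _).le (wt_pos _ _).le

lemma hasGrowth_norm_rpow {s : ℝ} (hs : 0 ≤ s) : HasGrowth ⌈s⌉₊ fun v => ‖v‖ ^ s := by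
  refine ⟨Continuous.stronglyMeasurable ?_, 1, zero_le_one, fun v => ?_⟩
  · exact (Real.continuous_rpow_const hs).comp continuous_norm
  · rw [abs_of_nonneg (by positivity), one_mul, wt, ← Real.rpow_natCast]
    calc ‖v‖ ^ s ≤ (1 + ‖v‖) ^ s := Real.rpow_le_rpow (norm_nonneg _) (by simp) hs
      _ ≤ _ := Real.rpow_le_rpow_of_exponent_le (by simp) (Nat.le_ceil s)

lemma hasGrowth_one : HasGrowth 0 fun _ => (1 : ℝ) :=
  ⟨stronglyMeasurable_const, 1, zero_le_one, fun v => by simp [wt]⟩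

lemma hasGrowth_norm : HasGrowth 1 fun v => ‖v‖ :=
  ⟨continuous_norm.stronglyMeasurable, 1, zero_le_one, fun v => by simp [wt]⟩

lemma HasGrowth.const_mul {N : ℕ} {ψ : Vel → ℝ} (h : HasGrowth N ψ) (a : ℝ) :
    HasGrowth N fun v => a * ψ v := by
  obtain ⟨c, hc, hb⟩ := h.bound
  refine ⟨h.meas.const_mul a, |a| * c, by positivity, fun v => ?_⟩
  rw [abs_mul, mul_assoc]
  exact mul_le_mul_of_nonneg_left (hb v) (abs_nonneg _)

lemma HasGrowth.mul {N M : ℕ} {ψ χ : Vel → ℝ} (h : HasGrowth N ψ) (h' : HasGrowth M χ) :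
    HasGrowth (N + M) fun v => ψ v * χ v := by
  obtain ⟨c, hc, hb⟩ := h.bound
  obtain ⟨d, hd, hb'⟩ := h'.bound
  refine ⟨h.meas.mul h'.meas, c * d, by positivity, fun v => ?_⟩
  rw [abs_mul, wt, pow_add]
  refine (mul_le_mul (hb v) (hb' v) (abs_nonneg _) ((abs_nonneg _).trans (hb v))).trans_eq ?_
  simp only [wt]
  ring

lemma hasGrowth_norm_sq : HasGrowth 2 fun v => ‖v‖ ^ 2 := by
  simpa [sq] using hasGrowth_norm.mul hasGrowth_norm

/-! ### Moment estimates for the two collision operators -/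

section linear
variable {r α β lam c : ℝ} {φ : ℝ → ℝ} {N : ℕ} {f F₁ : Vel → ℝ}

/-- The loss term is multiplied by `|q| ≥ |v| - |w|`, the error term by `|q| ≤ |v| + |w|`. The
kernel is thereby dominated by four products of functions of one variable. -/
lemma bil_kerJ_le (hr : 1 ≤ r) (h0 : 0 < α * (1 - β)) (h1 : α * (1 - β) < 1) (hc0 : 0 < c)
    (hc : ∀ v w : Vel, collJ α β (fun v => φ (‖v‖ ^ 2)) v w ≤
        -(α * (1 - β) * (1 - α * (1 - β))) * φ (‖v‖ ^ 2) + c * ‖w‖ ^ (2 * r))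
    (h : IsPowerLike r φ) (hφ : HasGrowth N fun v => φ (‖v‖ ^ 2))
    (hf : WInt (N + 1) f) (hf0 : ∀ᵐ v, 0 ≤ f v) (hf1 : ∫ v, f v = 1)
    (hF : ∀ N, WInt N F₁) (hF0 : ∀ᵐ v, 0 ≤ F₁ v) (hF1 : ∫ v, F₁ v = 1) :
    bil (kerJ α β fun v => φ (‖v‖ ^ 2)) f F₁ ≤
      -(α * (1 - β) * (1 - α * (1 - β))) * (∫ v, f v * (φ (‖v‖ ^ 2) * ‖v‖))
      + (α * (1 - β) * (1 - α * (1 - β))) * (∫ v, f v * φ (‖v‖ ^ 2)) * (∫ w, F₁ w * ‖w‖)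
      + c * (∫ v, f v * ‖v‖) * (∫ w, F₁ w * ‖w‖ ^ (2 * r))
      + c * (∫ w, F₁ w * (‖w‖ ^ (2 * r) * ‖w‖)) := by
  set k := α * (1 - β) * (1 - α * (1 - β)) with hk
  have hk0 : 0 < k := mul_pos h0 (by linarith)
  have hcont := continuous_comp_norm_sq h
  have g1 : HasGrowth (N + 1) fun v => -k * (φ (‖v‖ ^ 2) * ‖v‖) :=
    (hφ.mul hasGrowth_norm).const_mul _
  have g2 : HasGrowth (N + 1) fun v => k * φ (‖v‖ ^ 2) :=
    (hφ.mono (Nat.le_succ N)).const_mul _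
  have g3 : HasGrowth (N + 1) fun v => c * ‖v‖ :=
    (hasGrowth_norm.mono (by omega)).const_mul _
  have g4 : HasGrowth (N + 1) fun _ => c * 1 :=
    (hasGrowth_one.mono (by omega)).const_mul _
  -- The host has moments of every order, so its weight may be taken as large as the error terms
  -- require.
  set P := ⌈2 * r⌉₊ + N + 1
  have e1 : HasGrowth P fun _ => (1 : ℝ) := hasGrowth_one.mono (by omega)
  have e2 : HasGrowth P fun v => ‖v‖ := hasGrowth_norm.mono (by omega)
  have e3 : HasGrowth P fun v => ‖v‖ ^ (2 * r) :=
    (hasGrowth_norm_rpow (by linarith)).mono (by omega)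
  have e4 : HasGrowth P fun v => ‖v‖ ^ (2 * r) * ‖v‖ :=
    ((hasGrowth_norm_rpow (s := 2 * r) (by linarith)).mul hasGrowth_norm).mono (by omega)
  have k1 := g1.isKernel e1
  have k2 := g2.isKernel e2
  have k3 := g3.isKernel e3
  have k4 := g4.isKernel e4
  have hker := (isKernel_kerJ h0.le h1.le hφ hcont).mono le_rfl (by omega : N + 1 ≤ P)
  refine (bil_mono hf (hF P) hf0 hF0 hker (((k1.add k2).add k3).add k4) ?_).trans_eq ?_
  · intro v w
    have hφv := h.nonneg (‖v‖ ^ 2) (sq_nonneg _)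
    have hw : 0 ≤ c * ‖w‖ ^ (2 * r) := by positivity
    have h2 : ‖v‖ - ‖w‖ ≤ ‖v - w‖ := norm_sub_norm_le v w
    have h3 : ‖v - w‖ ≤ ‖v‖ + ‖w‖ := norm_sub_le v w
    refine (mul_le_mul_of_nonneg_left (hc v w) (norm_nonneg (v - w))).trans ?_
    have h4 := mul_le_mul_of_nonneg_right h2 (mul_nonneg hk0.le hφv)
    have h5 := mul_le_mul_of_nonneg_right h3 hw
    linarith
  · rw [bil_add hf (hF P) ((k1.add k2).add k3) k4, bil_add hf (hF P) (k1.add k2) k3,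
      bil_add hf (hF P) k1 k2, bil_mul, bil_mul, bil_mul, bil_mul]
    have i1 : ∀ (a : ℝ) (u : Vel → ℝ), ∫ v, f v * (a * u v) = a * ∫ v, f v * u v := by
      intro a u
      rw [← integral_const_mul]; congr 1; ext v; ring
    rw [i1, i1, i1, i1 c fun _ => 1]
    simp only [mul_one, hf1, hF1]

/-- Bernoulli's inequality, rescaled. Integrating this tangent line, taken at the mean, proves
Jensen's inequality. -/
lemma rpow_ge_tangent {p x y : ℝ} (hp : 1 < p) (hx : 0 ≤ x) (hy : 0 ≤ y) :
    y ^ p + p * y ^ (p - 1) * (x - y) ≤ x ^ p := by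
  rcases hy.eq_or_lt with rfl | hy
  · rw [Real.zero_rpow (by linarith), Real.zero_rpow (by linarith)]
    simp only [mul_zero, zero_mul, add_zero]
    positivity
  have h1 := one_add_mul_self_le_rpow_one_add (s := x / y - 1) (p := p)
    (by have : 0 ≤ x / y := by positivity
        linarith) hp.le
  rw [add_sub_cancel, Real.div_rpow hx hy.le, le_div_iff₀ (by positivity)] at h1
  refine le_trans (le_of_eq ?_) h1
  rw [Real.rpow_sub_one hy.ne']
  field_simp

/-- Since `φ(|v|²) ≤ |v|^(2r)`, one has `φ^(1+1/(2r)) ≤ φ |v|` pointwise; Jensen for the probability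
density `f` does the rest. This is where the exponent of the theorem arises. -/
lemma rpow_integral_le (hr : 1 ≤ r)
    (h : IsPowerLike r φ) (hφ : HasGrowth N fun v => φ (‖v‖ ^ 2))
    (hf : WInt (N + 1) f) (hf0 : ∀ᵐ v, 0 ≤ f v) (hf1 : ∫ v, f v = 1) :
    (∫ v, f v * φ (‖v‖ ^ 2)) ^ (1 + 1 / (2 * r)) ≤ ∫ v, f v * (φ (‖v‖ ^ 2) * ‖v‖) := by
  set y := ∫ v, f v * φ (‖v‖ ^ 2) with hy
  set p := 1 + 1 / (2 * r) with hp
  have hr0 : 0 < 1 / (2 * r) := by positivity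
  have hy0 : 0 ≤ y := by
    refine integral_nonneg_of_ae ?_
    filter_upwards [hf0] with v hv
    exact mul_nonneg hv (h.nonneg _ (sq_nonneg _))
  have hi1 : Integrable fun v => f v * φ (‖v‖ ^ 2) := hf.integrable (hφ.mono (Nat.le_succ N))
  have hi0 : Integrable f := by
    simpa using hf.integrable (hasGrowth_one.mono (Nat.zero_le _))
  have hpt : ∀ v : Vel, y ^ p + p * y ^ (p - 1) * (φ (‖v‖ ^ 2) - y) ≤ φ (‖v‖ ^ 2) * ‖v‖ := by
    intro v
    have hφv := h.nonneg (‖v‖ ^ 2) (sq_nonneg _)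
    refine (rpow_ge_tangent (by linarith) hφv hy0).trans ?_
    rw [hp, Real.rpow_add' hφv (by positivity), Real.rpow_one]
    refine mul_le_mul_of_nonneg_left ?_ hφv
    have h2 := Real.rpow_le_rpow hφv (h.le_rpow _ (sq_nonneg ‖v‖)) hr0.le
    rw [← Real.rpow_mul (sq_nonneg _), ← Real.rpow_two, ← Real.rpow_mul (norm_nonneg _),
      show 2 * (r * (1 / (2 * r))) = 1 by field_simp, Real.rpow_one, Real.rpow_two] at h2
    exact h2
  have hint : ∫ v, ((y ^ p - p * y ^ (p - 1) * y) * f v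
      + p * y ^ (p - 1) * (f v * φ (‖v‖ ^ 2))) = y ^ p := by
    rw [integral_add (hi0.const_mul _) (hi1.const_mul _), integral_const_mul,
      integral_const_mul, hf1, ← hy]
    ring
  rw [← hint]
  refine integral_mono_ae ((hi0.const_mul _).add (hi1.const_mul _))
    (hf.integrable (hφ.mul hasGrowth_norm)) ?_
  filter_upwards [hf0] with v hv
  have := mul_le_mul_of_nonneg_left (hpt v) hv
  linarith

lemma integral_norm_le (h : IsPowerLike r φ) (hφ : HasGrowth N fun v => φ (‖v‖ ^ 2))
    (hf : WInt (N + 1) f) (hf0 : ∀ᵐ v, 0 ≤ f v) (hf1 : ∫ v, f v = 1) :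
    ∫ v, f v * ‖v‖ ≤ 2 + ∫ v, f v * φ (‖v‖ ^ 2) := by
  have hi1 : Integrable fun v => f v * φ (‖v‖ ^ 2) := hf.integrable (hφ.mono (Nat.le_succ N))
  have hi0 : Integrable f := by
    simpa using hf.integrable (hasGrowth_one.mono (Nat.zero_le _))
  have : ∫ v, (2 * f v + f v * φ (‖v‖ ^ 2)) = 2 + ∫ v, f v * φ (‖v‖ ^ 2) := by
    rw [integral_add (hi0.const_mul _) hi1, integral_const_mul, hf1, mul_one]
  rw [← this]
  refine integral_mono_ae (hf.integrable (hasGrowth_norm.mono (by omega)))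
    ((hi0.const_mul _).add hi1) ?_
  filter_upwards [hf0] with v hv
  have h1 := h.le_one_add (‖v‖ ^ 2) (sq_nonneg _)
  have h2 : ‖v‖ ≤ 2 + φ (‖v‖ ^ 2) := by nlinarith [sq_nonneg (‖v‖ - 1), norm_nonneg v]
  have := mul_le_mul_of_nonneg_left h2 hv
  linarith

lemma hasGrowth_div_norm (hr : 1 ≤ r) (h : IsPowerLike r φ)
    (hφ : HasGrowth N fun v => φ (‖v‖ ^ 2)) : HasGrowth N fun v => φ (‖v‖ ^ 2) / ‖v‖ := by
  obtain ⟨c, hc, hb⟩ := hφ.bound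
  refine ⟨hφ.meas.div continuous_norm.stronglyMeasurable, c + 1, by positivity, fun v => ?_⟩
  have hφv := h.nonneg (‖v‖ ^ 2) (sq_nonneg _)
  have hbv := hb v
  rw [abs_of_nonneg hφv] at hbv
  rw [abs_of_nonneg (by positivity)]
  have h1 := one_le_wt N v
  rcases le_total 1 ‖v‖ with hv | hv
  · have := div_le_self hφv hv
    linarith
  · have h2 : φ (‖v‖ ^ 2) ≤ ‖v‖ ^ 2 := by
      refine (h.le_rpow _ (sq_nonneg _)).trans ?_
      simpa using Real.rpow_le_rpow_of_exponent_ge' (sq_nonneg ‖v‖)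
        (pow_le_one₀ (norm_nonneg v) hv) zero_le_one hr
    have h3 : φ (‖v‖ ^ 2) / ‖v‖ ≤ 1 := by
      refine div_le_one_of_le₀ (h2.trans ?_) (norm_nonneg v)
      nlinarith [norm_nonneg v]
    have : 0 ≤ c * wt N v := hφv.trans hbv
    linarith

/-- Below `|v| = 1/(1+b)` the quotient is at most `|v|`, because `φ(|v|²) ≤ |v|²` there; above it,
`1/|v| ≤ 1+b`. The additive constant does not depend on `b`, which keeps the energy out of the
constant `C`. -/
lemma mul_div_norm_le (hr : 1 ≤ r) (h : IsPowerLike r φ) {b : ℝ} (hb : 0 ≤ b) (v : Vel) :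
    b * (φ (‖v‖ ^ 2) / ‖v‖) ≤ 1 + b * (1 + b) * φ (‖v‖ ^ 2) := by
  have hφv := h.nonneg (‖v‖ ^ 2) (sq_nonneg _)
  rcases (norm_nonneg v).eq_or_lt with h0 | h0
  · rw [← h0] at hφv ⊢
    simp only [div_zero, mul_zero]
    positivity
  rcases le_total ((1 + b) * ‖v‖) 1 with hv | hv
  · have hv1 : ‖v‖ ≤ 1 := by nlinarith
    have h2 : φ (‖v‖ ^ 2) ≤ ‖v‖ ^ 2 := by
      refine (h.le_rpow _ (sq_nonneg _)).trans ?_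
      simpa using Real.rpow_le_rpow_of_exponent_ge' (sq_nonneg ‖v‖)
        (pow_le_one₀ (norm_nonneg v) hv1) zero_le_one hr
    have h3 : φ (‖v‖ ^ 2) / ‖v‖ ≤ ‖v‖ := by
      rw [div_le_iff₀ h0]; linarith
    have h4 := mul_le_mul_of_nonneg_left h3 hb
    have : 0 ≤ b * (1 + b) * φ (‖v‖ ^ 2) := by positivity
    linarith
  · have h3 : φ (‖v‖ ^ 2) / ‖v‖ ≤ (1 + b) * φ (‖v‖ ^ 2) := by
      rw [div_le_iff₀ h0]
      have := mul_le_mul_of_nonneg_right hv hφv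
      linarith
    have h4 := mul_le_mul_of_nonneg_left h3 hb
    linarith

lemma bil_kerA_le {ζ : ℝ} (h0 : 0 ≤ ζ) (h1 : ζ ≤ 1) (hr : 1 ≤ r)
    (h : IsPowerLike r φ) (hφ : HasGrowth N fun v => φ (‖v‖ ^ 2)) (hN : 1 ≤ N)
    (hf : WInt (N + 1) f) (hf0 : ∀ᵐ v, 0 ≤ f v) :
    bil (kerA ζ fun v => φ (‖v‖ ^ 2)) f f ≤
      2 * (2 ^ (r + 1) * (∫ v, f v * ‖v‖ ^ 2) * ∫ v, f v * (φ (‖v‖ ^ 2) / ‖v‖)) := by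
  have g1 : HasGrowth (N + 1) fun v => φ (‖v‖ ^ 2) / ‖v‖ :=
    (hasGrowth_div_norm hr h hφ).mono (Nat.le_succ N)
  have g2 : HasGrowth (N + 1) fun v => ‖v‖ ^ 2 := hasGrowth_norm_sq.mono (by omega)
  have k1 := (g1.const_mul (2 ^ (r + 1))).isKernel g2
  have k2 := (g2.const_mul (2 ^ (r + 1))).isKernel g1
  refine (bil_mono hf hf hf0 hf0 (isKernel_kerA h0 h1 hφ (continuous_comp_norm_sq h))
    (k1.add k2) fun v w => ?_).trans_eq ?_
  · refine (collA_le hr h h0 h1 v w).trans_eq ?_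
    ring
  · rw [bil_add hf hf k1 k2, bil_mul, bil_mul]
    have i1 : ∀ (a : ℝ) (u : Vel → ℝ), ∫ v, f v * (a * u v) = a * ∫ v, f v * u v := by
      intro a u
      rw [← integral_const_mul]; congr 1; ext v; ring
    rw [i1, i1]
    ring

lemma weakQ_nonpos {ε : ℝ} (h0 : 0 ≤ ε) (h1 : ε ≤ 1) (h : IsPowerLike 1 φ)
    (hf0 : ∀ᵐ v, 0 ≤ f v) : weakQ ε f (fun v => φ (‖v‖ ^ 2)) ≤ 0 := by
  rw [weakQ_eq]
  refine mul_nonpos_of_nonneg_of_nonpos (by norm_num) (integral_nonpos_of_ae ?_)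
  filter_upwards [hf0] with v hv
  refine integral_nonpos_of_ae ?_
  filter_upwards [hf0] with w hw
  exact mul_nonpos_of_nonneg_of_nonpos (mul_nonneg hv hw)
    (mul_nonpos_of_nonneg_of_nonpos (norm_nonneg _)
      (collA_nonpos h (by linarith) (by linarith) v w))

/-- The energy bound `B` enters only through the product `b` of `τ`, a power of `2` and `B`, so it
disappears when `τ = 0`. -/
lemma mul_weakQ_le {ε τ B : ℝ} (h0 : 0 ≤ ε) (h1 : ε ≤ 1) (hτ : 0 ≤ τ) (hr : 1 ≤ r)
    (h : IsPowerLike r φ) (hφ : HasGrowth N fun v => φ (‖v‖ ^ 2)) (hN : 1 ≤ N)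
    (hf : WInt (N + 1) f) (hf0 : ∀ᵐ v, 0 ≤ f v) (hf1 : ∫ v, f v = 1)
    (hB : ∫ v, f v * ‖v‖ ^ 2 ≤ B) (hB0 : 0 ≤ B) :
    τ * weakQ ε f (fun v => φ (‖v‖ ^ 2)) ≤
      1 + (τ * 2 ^ (r + 1) * B) * (1 + τ * 2 ^ (r + 1) * B) * ∫ v, f v * φ (‖v‖ ^ 2) := by
  set b := τ * 2 ^ (r + 1) * B
  have hb : 0 ≤ b := by positivity
  have hi1 : Integrable fun v => f v * φ (‖v‖ ^ 2) := hf.integrable (hφ.mono (Nat.le_succ N))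
  have hi0 : Integrable f := by
    simpa using hf.integrable (hasGrowth_one.mono (Nat.zero_le _))
  have hi2 : Integrable fun v => f v * (φ (‖v‖ ^ 2) / ‖v‖) :=
    hf.integrable ((hasGrowth_div_norm hr h hφ).mono (Nat.le_succ N))
  have hnn : 0 ≤ ∫ v, f v * (φ (‖v‖ ^ 2) / ‖v‖) := by
    refine integral_nonneg_of_ae ?_
    filter_upwards [hf0] with v hv
    have := h.nonneg (‖v‖ ^ 2) (sq_nonneg _)
    positivity
  have e1 := bil_kerA_le (ζ := (1 + ε) / 2) (by linarith) (by linarith) hr h hφ hN hf hf0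
  have e2 : b * ∫ v, f v * (φ (‖v‖ ^ 2) / ‖v‖) ≤
      1 + b * (1 + b) * ∫ v, f v * φ (‖v‖ ^ 2) := by
    have : ∫ v, (f v + b * (1 + b) * (f v * φ (‖v‖ ^ 2))) =
        1 + b * (1 + b) * ∫ v, f v * φ (‖v‖ ^ 2) := by
      rw [integral_add hi0 (hi1.const_mul _), integral_const_mul, hf1]
    rw [← this, ← integral_const_mul]
    refine integral_mono_ae (hi2.const_mul _) (hi0.add (hi1.const_mul _)) ?_
    filter_upwards [hf0] with v hv
    have := mul_le_mul_of_nonneg_left (mul_div_norm_le hr h hb v) hv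
    linarith
  refine le_trans ?_ e2
  rw [weakQ_eq]
  have e3 : 2 ^ (r + 1) * (∫ v, f v * ‖v‖ ^ 2) * (∫ v, f v * (φ (‖v‖ ^ 2) / ‖v‖)) ≤
      2 ^ (r + 1) * B * ∫ v, f v * (φ (‖v‖ ^ 2) / ‖v‖) := by
    gcongr
  have e4 : (1 / 2) * bil (kerA ((1 + ε) / 2) fun v => φ (‖v‖ ^ 2)) f f ≤
      2 ^ (r + 1) * B * ∫ v, f v * (φ (‖v‖ ^ 2) / ‖v‖) := by linarith
  refine (mul_le_mul_of_nonneg_left e4 hτ).trans_eq ?_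
  simp only [b]
  ring

lemma weakL_le (hr : 1 ≤ r) (hlam : 0 < lam) (h0 : 0 < α * (1 - β)) (h1 : α * (1 - β) < 1)
    (hc0 : 0 < c)
    (hc : ∀ v w : Vel, collJ α β (fun v => φ (‖v‖ ^ 2)) v w ≤
        -(α * (1 - β) * (1 - α * (1 - β))) * φ (‖v‖ ^ 2) + c * ‖w‖ ^ (2 * r))
    (h : IsPowerLike r φ) (hφ : HasGrowth N fun v => φ (‖v‖ ^ 2))
    (hf : WInt (N + 1) f) (hf0 : ∀ᵐ v, 0 ≤ f v) (hf1 : ∫ v, f v = 1)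
    (hF : ∀ N, WInt N F₁) (hF0 : ∀ᵐ v, 0 ≤ F₁ v) (hF1 : ∫ v, F₁ v = 1) :
    weakL α β lam F₁ f (fun v => φ (‖v‖ ^ 2)) ≤
      1 / lam * (2 * c * (∫ w, F₁ w * ‖w‖ ^ (2 * r)) + c * ∫ w, F₁ w * (‖w‖ ^ (2 * r) * ‖w‖))
      + 1 / lam * (α * (1 - β) * (1 - α * (1 - β)) * (∫ w, F₁ w * ‖w‖)
        + c * ∫ w, F₁ w * ‖w‖ ^ (2 * r)) * (∫ v, f v * φ (‖v‖ ^ 2))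
      - 1 / lam * (α * (1 - β) * (1 - α * (1 - β))) *
        (∫ v, f v * φ (‖v‖ ^ 2)) ^ (1 + 1 / (2 * r)) := by
  have e1 := bil_kerJ_le hr h0 h1 hc0 hc h hφ hf hf0 hf1 hF hF0 hF1
  have e2 := rpow_integral_le hr h hφ hf hf0 hf1
  have e3 := integral_norm_le h hφ hf hf0 hf1
  set k := α * (1 - β) * (1 - α * (1 - β)) with hk
  have hk0 : 0 < k := mul_pos h0 (by linarith)
  have hM : 0 ≤ ∫ w, F₁ w * ‖w‖ ^ (2 * r) := by
    refine integral_nonneg_of_ae ?_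
    filter_upwards [hF0] with v hv
    positivity
  have e4 := mul_le_mul_of_nonneg_left e2 hk0.le
  have e5 := mul_le_mul_of_nonneg_right (mul_le_mul_of_nonneg_left e3 hc0.le) hM
  rw [weakL_eq]
  have hl : 0 ≤ 1 / lam := by positivity
  refine (mul_le_mul_of_nonneg_left (e1.trans (b := _) (c :=
    (2 * c * (∫ w, F₁ w * ‖w‖ ^ (2 * r)) + c * ∫ w, F₁ w * (‖w‖ ^ (2 * r) * ‖w‖))
    + (k * (∫ w, F₁ w * ‖w‖) + c * ∫ w, F₁ w * ‖w‖ ^ (2 * r)) * (∫ v, f v * φ (‖v‖ ^ 2))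
    - k * (∫ v, f v * φ (‖v‖ ^ 2)) ^ (1 + 1 / (2 * r))) (by linarith)) hl).trans_eq ?_
  ring

end linear

/-! ### Comparison of weighted norms and approximation by test functions -/

lemma wt_le_two_pow_mul (N : ℕ) (v : Vel) :
    wt N v ≤ 2 ^ N * Real.sqrt (1 + ‖v‖ ^ 2) ^ (N : ℝ) := by
  rw [Real.rpow_natCast, ← mul_pow, wt]
  refine pow_le_pow_left₀ (by positivity) ?_ N
  have h1 : (1 : ℝ) ≤ Real.sqrt (1 + ‖v‖ ^ 2) := Real.one_le_sqrt.2 (by nlinarith [sq_nonneg ‖v‖])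
  have h2 : ‖v‖ ≤ Real.sqrt (1 + ‖v‖ ^ 2) := Real.le_sqrt_of_sq_le (by linarith)
  linarith

lemma lintegral_wt_le_normL1 (N : ℕ) (g : Vel → ℝ) :
    ∫⁻ v, ENNReal.ofReal (|g v| * wt N v) ≤ ENNReal.ofReal (2 ^ N) * normL1 N g := by
  rw [normL1, ← lintegral_const_mul' _ _ ENNReal.ofReal_ne_top]
  refine lintegral_mono fun v => ?_
  rw [← ENNReal.ofReal_mul (by positivity)]
  refine ENNReal.ofReal_le_ofReal ?_
  have := mul_le_mul_of_nonneg_left (wt_le_two_pow_mul N v) (abs_nonneg (g v))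
  linarith

lemma wInt_iff {N : ℕ} {g : Vel → ℝ} (hm : AEMeasurable g) :
    WInt N g ↔ ∫⁻ v, ENNReal.ofReal (|g v| * wt N v) < ∞ := by
  have hm' : AEStronglyMeasurable fun v => g v * wt N v :=
    hm.aestronglyMeasurable.mul (continuous_wt N).aestronglyMeasurable
  have : ∀ v, ENNReal.ofReal (|g v| * wt N v) = ‖g v * wt N v‖ₑ := fun v => by
    rw [← ofReal_norm, norm_mul, Real.norm_of_nonneg (wt_pos N v).le, Real.norm_eq_abs]
  simp only [this, WInt]
  exact ⟨fun h => h.2, fun h => ⟨hm', h⟩⟩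

lemma integral_abs_mul_wt {N : ℕ} {g : Vel → ℝ} (hm : AEMeasurable g) :
    ∫ v, |g v| * wt N v = (∫⁻ v, ENNReal.ofReal (|g v| * wt N v)).toReal := by
  refine integral_eq_lintegral_of_nonneg_ae
    (.of_forall fun v => mul_nonneg (abs_nonneg _) (wt_pos N v).le) ?_
  exact (continuous_abs.measurable.comp_aemeasurable hm).aestronglyMeasurable.mul
    (continuous_wt N).aestronglyMeasurable

lemma lintegral_le_of_forall_ball {h : Vel → ℝ≥0∞} {B : ℝ≥0∞}
    (H : ∀ n : ℕ, ∫⁻ v in Metric.closedBall 0 n, h v ≤ B) : ∫⁻ v, h v ≤ B := by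
  have hd : Directed (· ⊆ ·) fun n : ℕ => Metric.closedBall (0 : Vel) n :=
    Monotone.directed_le fun m n hmn => Metric.closedBall_subset_closedBall (by exact_mod_cast hmn)
  have h2 := setLIntegral_iUnion_of_directed (μ := volume) h hd
  rw [Metric.iUnion_closedBall_nat, Measure.restrict_univ] at h2
  rw [h2]
  exact iSup_le H

/-- On a ball the stronger weight is a bounded multiple of the weaker one, so closeness in the
weaker norm transfers a bound in the stronger norm from `g` to `f`. -/
lemma setLIntegral_closedBall_le {N : ℕ} {f g : Vel → ℝ} (hg : AEMeasurable g) (R : ℝ)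
    (hR : 0 ≤ R) :
    ∫⁻ v in Metric.closedBall 0 R, ENNReal.ofReal (|f v| * wt (N + 1) v) ≤
      (∫⁻ v, ENNReal.ofReal (|g v| * wt (N + 1) v)) +
        ENNReal.ofReal (1 + R) * ∫⁻ v, ENNReal.ofReal (|g v - f v| * wt N v) := by
  rw [← lintegral_const_mul' _ _ ENNReal.ofReal_ne_top, ← lintegral_add_left']
  · refine (setLIntegral_mono_ae' Metric.isClosed_closedBall.measurableSet
      (.of_forall fun v hv => ?_)).trans (setLIntegral_le_lintegral _ _)
    rw [mem_closedBall_zero_iff] at hv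
    rw [← ENNReal.ofReal_mul (by positivity), ← ENNReal.ofReal_add
      (mul_nonneg (abs_nonneg _) (wt_pos _ _).le)
      (mul_nonneg (by positivity) (mul_nonneg (abs_nonneg _) (wt_pos _ _).le))]
    refine ENNReal.ofReal_le_ofReal ?_
    have h1 : |f v| ≤ |g v| + |g v - f v| := by
      have := abs_sub_abs_le_abs_sub (f v) (g v)
      rw [abs_sub_comm (f v)] at this
      linarith
    have h2 := mul_le_mul_of_nonneg_right h1 (wt_pos (N + 1) v).le
    have h3 : |g v - f v| * wt (N + 1) v ≤ (1 + R) * (|g v - f v| * wt N v) := by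
      rw [wt_succ]
      have := mul_le_mul_of_nonneg_left (show 1 + ‖v‖ ≤ 1 + R by linarith)
        (mul_nonneg (abs_nonneg (g v - f v)) (wt_pos N v).le)
      linarith
    linarith
  · exact ((continuous_abs.measurable.comp_aemeasurable hg).mul
      (continuous_wt _).measurable.aemeasurable).ennreal_ofReal

/-- Approximation of continuous functions of polynomial growth by test functions. -/
lemma exists_testFunction_seq {ψ : Vel → ℝ} (hψ : Continuous ψ) {c : ℝ} {N : ℕ}
    (hc : ∀ v, |ψ v| ≤ c * wt N v) :
    ∃ ψs : ℕ → Vel → ℝ, (∀ n, ContDiff ℝ (⊤ : ℕ∞) (ψs n)) ∧ (∀ n, HasCompactSupport (ψs n)) ∧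
      (∀ n v, |ψs n v| ≤ (c + 1) * wt N v) ∧
      ∀ v, Tendsto (fun n => ψs n v) atTop (𝓝 (ψ v)) := by
  have hχ : ∀ n : ℕ, Continuous fun v : Vel => max 0 (min 1 ((n : ℝ) + 1 - ‖v‖)) * ψ v :=
    fun n => by fun_prop
  have hpos : ∀ n : ℕ, (0 : ℝ) < 1 / ((n : ℝ) + 1) := fun n => by positivity
  -- The smoothing keeps the support of the cut-off function and has error below `1/(n+1) ≤ 1`,
  -- whence the constant `c + 1`.
  choose ψs h1 h2 h3 using fun n : ℕ => (hχ n).exists_contDiff_approx (⊤ : ℕ∞)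
    (continuous_const (y := 1 / ((n : ℝ) + 1))) (fun _ => hpos n)
  have hχ1 : ∀ (n : ℕ) (v : Vel), |max 0 (min 1 ((n : ℝ) + 1 - ‖v‖))| ≤ 1 := fun n v => by
    rw [abs_of_nonneg (le_max_left _ _)]
    exact max_le zero_le_one (min_le_left _ _)
  refine ⟨ψs, h1, fun n => ?_, fun n v => ?_, fun v => ?_⟩
  · refine HasCompactSupport.of_support_subset_isCompact
      (isCompact_closedBall (0 : Vel) ((n : ℝ) + 1)) ((h3 n).trans fun v hv => ?_)
    rw [mem_closedBall_zero_iff]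
    by_contra! hlt
    apply hv
    have : min 1 ((n : ℝ) + 1 - ‖v‖) ≤ 0 := (min_le_right _ _).trans (by linarith)
    simp [max_eq_left this]
  · have h4 := (h2 n v).le
    rw [Real.dist_eq] at h4
    have h5 : 1 / ((n : ℝ) + 1) ≤ 1 := by
      rw [div_le_one (by positivity)]
      have : (0 : ℝ) ≤ n := n.cast_nonneg
      linarith
    have h6 : |max 0 (min 1 ((n : ℝ) + 1 - ‖v‖)) * ψ v| ≤ |ψ v| := by
      rw [abs_mul]
      exact mul_le_of_le_one_left (abs_nonneg _) (hχ1 n v)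
    have h7 := abs_sub_abs_le_abs_sub (ψs n v) (max 0 (min 1 ((n : ℝ) + 1 - ‖v‖)) * ψ v)
    have := hc v
    have := one_le_wt N v
    linarith
  · rw [tendsto_iff_dist_tendsto_zero]
    refine squeeze_zero' (.of_forall fun _ => dist_nonneg) ?_
      (tendsto_one_div_add_atTop_nhds_zero_nat (𝕜 := ℝ))
    obtain ⟨m, hm⟩ := exists_nat_ge ‖v‖
    filter_upwards [eventually_ge_atTop m] with n hn
    have hn' : (m : ℝ) ≤ n := by exact_mod_cast hn
    have h4 := (h2 n v).le
    rwa [min_eq_left (by linarith), max_eq_right zero_le_one, one_mul] at h4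

lemma tendsto_integral_mul {ι : Type*} {l : Filter ι} {N : ℕ} {fs : ι → Vel → ℝ} {f ψ : Vel → ℝ}
    (hfs : ∀ᶠ i in l, WInt N (fs i)) (hf : WInt N f)
    (hl : Tendsto (fun i => ∫ v, |fs i v - f v| * wt N v) l (𝓝 0)) (hψ : HasGrowth N ψ) :
    Tendsto (fun i => ∫ v, fs i v * ψ v) l (𝓝 (∫ v, f v * ψ v)) := by
  obtain ⟨c, hc, hb⟩ := hψ.bound
  rw [tendsto_iff_norm_sub_tendsto_zero]
  refine squeeze_zero' (.of_forall fun _ => norm_nonneg _) ?_ (by simpa using hl.const_mul c)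
  filter_upwards [hfs] with i hi
  rw [← integral_sub (hi.integrable hψ) (hf.integrable hψ), ← integral_const_mul]
  refine norm_integral_le_of_norm_le ((hi.sub hf).abs.const_mul c) (.of_forall fun v => ?_)
  rw [← sub_mul, norm_mul, Real.norm_eq_abs, Real.norm_eq_abs]
  have := mul_le_mul_of_nonneg_left (hb v) (abs_nonneg (fs i v - f v))
  linarith

/-! ### Continuity and bounds of the weak right-hand side -/

/-- The weak form of the right-hand side `τ 𝒬(f,f) + ℒ(f)`. -/
noncomputable def rhs (τ lam α β ε : ℝ) (F₁ f ψ : Vel → ℝ) : ℝ :=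
  τ * weakQ ε f ψ + weakL α β lam F₁ f ψ

section rhs
variable {τ lam α β ε : ℝ} {F₁ : Vel → ℝ}

lemma tendsto_rhs (hε0 : 0 ≤ ε) (hε1 : ε ≤ 1) (h0 : 0 ≤ α * (1 - β)) (h1 : α * (1 - β) ≤ 1)
    {N : ℕ} (hF : WInt (N + 1) F₁) {ι : Type*} {l : Filter ι} {fs : ι → Vel → ℝ} {f ψ : Vel → ℝ}
    (hfs : ∀ᶠ i in l, WInt (N + 1) (fs i)) (hf : WInt (N + 1) f)
    (hl : Tendsto (fun i => ∫ v, |fs i v - f v| * wt (N + 1) v) l (𝓝 0))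
    (hψ : HasGrowth N ψ) (hcont : Continuous ψ) :
    Tendsto (fun i => rhs τ lam α β ε F₁ (fs i) ψ) l (𝓝 (rhs τ lam α β ε F₁ f ψ)) := by
  simp only [rhs, weakQ_eq, weakL_eq]
  have kA := isKernel_kerA (ζ := (1 + ε) / 2) (by linarith) (by linarith) hψ hcont
  have kJ := isKernel_kerJ h0 h1 hψ hcont
  obtain ⟨c, hc⟩ := kA.bound
  obtain ⟨d, hd⟩ := kJ.bound
  refine (((tendsto_bil hfs hfs hf hf hl hl kA.meas hc).const_mul _).const_mul _).add
    ((tendsto_bil hfs (.of_forall fun _ => hF) hf hF hl ?_ kJ.meas hd).const_mul _)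
  simpa using tendsto_const_nhds

lemma exists_abs_rhs_le (hε0 : 0 ≤ ε) (hε1 : ε ≤ 1) (h0 : 0 ≤ α * (1 - β))
    (h1 : α * (1 - β) ≤ 1) {N : ℕ} (hF : WInt (N + 1) F₁) (B c : ℝ) (hc : 0 ≤ c) :
    ∃ L, ∀ f ψ : Vel → ℝ, WInt (N + 1) f → ∫ v, |f v| * wt (N + 1) v ≤ B → Continuous ψ →
      (∀ v, |ψ v| ≤ c * wt N v) → |rhs τ lam α β ε F₁ f ψ| ≤ L := by
  refine ⟨|τ| * (1 / 2 * (4 * 3 ^ N * c * (B * B))) +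
    |1 / lam| * (4 * 3 ^ N * c * (B * ∫ v, |F₁ v| * wt (N + 1) v)),
    fun f ψ hf hB hcont hψ => ?_⟩
  have hA := abs_bil_le hf hf (stronglyMeasurable_kerA hcont ((1 + ε) / 2))
    (abs_kerA_le (by linarith) (by linarith) hc hψ)
  have hJ := abs_bil_le hf hF (stronglyMeasurable_kerJ hcont α β) (abs_kerJ_le h0 h1 hc hψ)
  have hf0 : 0 ≤ ∫ v, |f v| * wt (N + 1) v :=
    integral_nonneg fun v => mul_nonneg (abs_nonneg _) (wt_pos _ _).le
  have hF0 : 0 ≤ ∫ v, |F₁ v| * wt (N + 1) v :=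
    integral_nonneg fun v => mul_nonneg (abs_nonneg _) (wt_pos _ _).le
  have hB0 : 0 ≤ B := hf0.trans hB
  rw [rhs, weakQ_eq, weakL_eq]
  refine (abs_add_le _ _).trans ?_
  rw [abs_mul, abs_mul, abs_mul, abs_of_pos (by norm_num : (0 : ℝ) < 1 / 2)]
  gcongr
  · exact hA.trans (by gcongr)
  · exact hJ.trans (by gcongr)

lemma tendsto_rhs_test (hε0 : 0 ≤ ε) (hε1 : ε ≤ 1) (h0 : 0 ≤ α * (1 - β))
    (h1 : α * (1 - β) ≤ 1) {N : ℕ} (hF : WInt (N + 1) F₁) {f : Vel → ℝ} (hf : WInt (N + 1) f)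
    {c : ℝ} (hc : 0 ≤ c) {ψs : ℕ → Vel → ℝ} {ψ : Vel → ℝ} (hcont : ∀ n, Continuous (ψs n))
    (hψ : ∀ n v, |ψs n v| ≤ c * wt N v)
    (H : ∀ v, Tendsto (fun n => ψs n v) atTop (𝓝 (ψ v))) :
    Tendsto (fun n => rhs τ lam α β ε F₁ f (ψs n)) atTop (𝓝 (rhs τ lam α β ε F₁ f ψ)) := by
  simp only [rhs, weakQ_eq, weakL_eq]
  have hζ0 : 0 ≤ (1 + ε) / 2 := by linarith
  have hζ1 : (1 + ε) / 2 ≤ 1 := by linarith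
  exact (((tendsto_bil_kernel hf hf (fun n => stronglyMeasurable_kerA (hcont n) _)
    (fun n => abs_kerA_le hζ0 hζ1 hc (hψ n)) (tendsto_kerA hcont hζ0 hζ1 hc hψ H)).const_mul
    _).const_mul _).add ((tendsto_bil_kernel hf hF
    (fun n => stronglyMeasurable_kerJ (hcont n) α β)
    (fun n => abs_kerJ_le h0 h1 hc (hψ n)) (tendsto_kerJ hcont h0 h1 hc hψ H)).const_mul _)

end rhs

/-! ### Extension of the weak formulation to polynomially growing test functions -/

namespace IsSolution
variable {τ lam α β ε : ℝ} {F₁ : Vel → ℝ} {f : ℝ → Vel → ℝ}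

lemma wInt_two (h : IsSolution τ lam α β ε F₁ f) {t : ℝ} (ht : 0 ≤ t) : WInt 2 (f t) := by
  rw [wInt_iff (h.aemeasurable t ht)]
  refine (lintegral_wt_le_normL1 2 (f t)).trans_lt ?_
  exact ENNReal.mul_lt_top ENNReal.ofReal_lt_top
    (by simpa using h.normL1_two_lt_top t ht)

lemma tendsto_lintegral_two (h : IsSolution τ lam α β ε F₁ f) {t : ℝ} (ht : 0 ≤ t) :
    Tendsto (fun s => ∫⁻ v, ENNReal.ofReal (|f s v - f t v| * wt 2 v)) (𝓝[Ici 0] t) (𝓝 0) := by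
  have h1 := ENNReal.Tendsto.const_mul (a := ENNReal.ofReal (2 ^ 2)) (h.continuous t ht)
    (.inr ENNReal.ofReal_ne_top)
  rw [mul_zero] at h1
  refine tendsto_of_tendsto_of_tendsto_of_le_of_le tendsto_const_nhds h1 (fun _ => zero_le)
    fun s => ?_
  simpa using lintegral_wt_le_normL1 2 fun v => f s v - f t v

lemma tendsto_two (h : IsSolution τ lam α β ε F₁ f) {t : ℝ} (ht : 0 ≤ t) :
    Tendsto (fun s => ∫ v, |f s v - f t v| * wt 2 v) (𝓝[Ici 0] t) (𝓝 0) := by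
  have h1 := (ENNReal.tendsto_toReal ENNReal.zero_ne_top).comp (h.tendsto_lintegral_two ht)
  rw [ENNReal.toReal_zero] at h1
  refine h1.congr' ?_
  filter_upwards [self_mem_nhdsWithin] with s hs
  exact (integral_abs_mul_wt ((h.aemeasurable s hs).sub (h.aemeasurable t ht))).symm

/-- The `L¹₃` bound, assumed only for almost every time, holds at every time: good times are dense,
`L¹₂` continuity carries the bound to any `t` on each ball, and the balls exhaust the space. -/
lemma exists_bound_three (h : IsSolution τ lam α β ε F₁ f) {T : ℝ} (hT : 0 < T) :
    ∃ B : ℝ, ∀ t ∈ Icc 0 T, WInt 3 (f t) ∧ ∫ v, |f t v| * wt 3 v ≤ B := by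
  obtain ⟨B, hB⟩ := h.bounded T hT
  set B' : ℝ≥0∞ := ENNReal.ofReal (2 ^ 3) * B with hB'
  have hB'top : B' < ∞ := ENNReal.mul_lt_top ENNReal.ofReal_lt_top ENNReal.coe_lt_top
  have hgood : ∀ᵐ s ∂(volume : Measure ℝ), s ∈ Ioo 0 T →
      ∫⁻ v, ENNReal.ofReal (|f s v| * wt 3 v) ≤ B' := by
    filter_upwards [(ae_restrict_iff' measurableSet_Icc).1 hB] with s hs hsT
    refine (lintegral_wt_le_normL1 3 (f s)).trans ?_
    rw [hB']
    gcongr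
    simpa using hs (Ioo_subset_Icc_self hsT)
  have hdense := Measure.dense_of_ae hgood
  have key : ∀ t ∈ Icc 0 T, ∫⁻ v, ENNReal.ofReal (|f t v| * wt 3 v) ≤ B' := by
    intro t ht
    refine lintegral_le_of_forall_ball fun n => ?_
    refine ENNReal.le_of_forall_pos_le_add fun δ hδ _ => ?_
    have hlim := ENNReal.Tendsto.const_mul (a := ENNReal.ofReal (1 + n))
      (h.tendsto_lintegral_two ht.1) (.inr ENNReal.ofReal_ne_top)
    rw [mul_zero] at hlim
    have hev := hlim.eventually_lt_const (show (0 : ℝ≥0∞) < δ by exact_mod_cast hδ)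
    obtain ⟨U, hU, htU, hUsub⟩ := mem_nhdsWithin.1 hev
    have hcl : t ∈ closure (Ioo 0 T) := by rwa [closure_Ioo hT.ne]
    obtain ⟨x, hx⟩ := mem_closure_iff.1 hcl U hU htU
    obtain ⟨s, ⟨hsU, hsT⟩, hs⟩ := hdense.exists_mem_open (hU.inter isOpen_Ioo) ⟨x, hx⟩
      |>.imp fun s hs => hs.symm
    refine (setLIntegral_closedBall_le (N := 2) (h.aemeasurable s hsT.1.le) n
      n.cast_nonneg).trans (add_le_add (hs hsT) ?_)
    exact (hUsub ⟨hsU, hsT.1.le⟩).le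
  refine ⟨B'.toReal, fun t ht => ?_⟩
  have hm := h.aemeasurable t ht.1
  rw [wInt_iff hm, integral_abs_mul_wt hm]
  exact ⟨(key t ht).trans_lt hB'top, ENNReal.toReal_mono hB'top.ne (key t ht)⟩

section weak
variable (h : IsSolution τ lam α β ε F₁ f) (hε0 : 0 ≤ ε) (hε1 : ε ≤ 1)
  (h0 : 0 ≤ α * (1 - β)) (h1 : α * (1 - β) ≤ 1) (hF : ∀ N, WInt N F₁)
include h

lemma continuousOn_integral {ψ : Vel → ℝ} (hψ : HasGrowth 2 ψ) :
    ContinuousOn (fun t => ∫ v, f t v * ψ v) (Ici 0) := by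
  intro t ht
  refine tendsto_integral_mul ?_ (h.wInt_two ht) (h.tendsto_two ht) hψ
  filter_upwards [self_mem_nhdsWithin] with s hs
  exact h.wInt_two hs

include hε0 hε1 h0 h1 hF

lemma continuousOn_rhs {ψ : Vel → ℝ} (hψ : HasGrowth 1 ψ) (hcont : Continuous ψ) :
    ContinuousOn (fun t => rhs τ lam α β ε F₁ (f t) ψ) (Ici 0) := by
  intro t ht
  refine tendsto_rhs hε0 hε1 h0 h1 (hF 2) ?_ (h.wInt_two ht) (h.tendsto_two ht) hψ hcont
  filter_upwards [self_mem_nhdsWithin] with s hs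
  exact h.wInt_two hs

/-- The weak formulation, integrated in time, for continuous functions of polynomial growth. -/
theorem weak_form {N : ℕ} {B a b : ℝ} (ha : 0 ≤ a) (hab : a ≤ b)
    (hB : ∀ t ∈ Icc a b, WInt (N + 1) (f t) ∧ ∫ v, |f t v| * wt (N + 1) v ≤ B)
    {ψ : Vel → ℝ} (hψ : HasGrowth N ψ) (hcont : Continuous ψ) :
    IntervalIntegrable (fun t => rhs τ lam α β ε F₁ (f t) ψ) volume a b ∧
      ∫ t in a..b, rhs τ lam α β ε F₁ (f t) ψ = (∫ v, f b v * ψ v) - ∫ v, f a v * ψ v := by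
  obtain ⟨c, hc, hb⟩ := hψ.bound
  obtain ⟨ψs, hs1, hs2, hs3, hs4⟩ := exists_testFunction_seq hcont hb
  have hc1 : 0 ≤ c + 1 := by linarith
  obtain ⟨L, hL⟩ := exists_abs_rhs_le (τ := τ) (lam := lam) hε0 hε1 h0 h1 (hF (N + 1)) B (c + 1) hc1
  have hsub : Icc a b ⊆ Ici 0 := fun t ht => ha.trans ht.1
  have hgr : ∀ n, HasGrowth 0 (ψs n) := fun n => by
    obtain ⟨C, hC⟩ := (hs2 n).exists_bound_of_continuous (hs1 n).continuous
    have hC0 : 0 ≤ C := (norm_nonneg _).trans (hC 0)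
    exact ⟨(hs1 n).continuous.stronglyMeasurable, C, hC0, fun v => by simpa [wt] using hC v⟩
  -- For bounded test functions the kernels grow at most linearly in each variable, so `L¹₂`
  -- continuity in time is enough here. For `ψ` itself only measurability in time is obtained, as a
  -- pointwise limit.
  have hcn : ∀ n, ContinuousOn (fun t => rhs τ lam α β ε F₁ (f t) (ψs n)) (Icc a b) := fun n =>
    (h.continuousOn_rhs hε0 hε1 h0 h1 hF ((hgr n).mono zero_le_one) (hs1 n).continuous).mono hsub
  have hint : ∀ n, IntervalIntegrable (fun t => rhs τ lam α β ε F₁ (f t) (ψs n)) volume a b :=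
    fun n => (hcn n).intervalIntegrable_of_Icc hab
  have hFTC : ∀ n, ∫ t in a..b, rhs τ lam α β ε F₁ (f t) (ψs n) =
      (∫ v, f b v * ψs n v) - ∫ v, f a v * ψs n v := by
    intro n
    refine intervalIntegral.integral_eq_sub_of_hasDeriv_right_of_le hab
      (f := fun t => ∫ v, f t v * ψs n v) ?_ ?_ (hint n)
    · exact (h.continuousOn_integral ((hgr n).mono (Nat.zero_le 2))).mono hsub
    · intro x hx
      refine (h.equation (ψs n) (hs1 n) (hs2 n) x (ha.trans hx.1.le)).mono fun y hy => ?_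
      exact (ha.trans hx.1.le).trans (le_of_lt hy)
  have hlim : ∀ t ∈ Icc a b, Tendsto (fun n => rhs τ lam α β ε F₁ (f t) (ψs n)) atTop
      (𝓝 (rhs τ lam α β ε F₁ (f t) ψ)) := fun t ht =>
    tendsto_rhs_test hε0 hε1 h0 h1 (hF (N + 1)) (hB t ht).1 hc1 (fun n => (hs1 n).continuous)
      hs3 hs4
  have huIoc : uIoc a b = Ioc a b := uIoc_of_le hab
  have hmeas : ∀ n, AEStronglyMeasurable (fun t => rhs τ lam α β ε F₁ (f t) (ψs n))
      (volume.restrict (uIoc a b)) := fun n => (intervalIntegrable_iff.1 (hint n)).aestronglyMeasurable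
  have hbd : ∀ n, ∀ t ∈ Icc a b, ‖rhs τ lam α β ε F₁ (f t) (ψs n)‖ ≤ L := fun n t ht =>
    hL _ _ (hB t ht).1 (hB t ht).2 (hs1 n).continuous (hs3 n)
  refine ⟨?_, ?_⟩
  · rw [intervalIntegrable_iff]
    refine Integrable.mono' (g := fun _ => L) (integrableOn_const (by rw [huIoc]; simp)) ?_ ?_
    · refine aestronglyMeasurable_of_tendsto_ae (μ := volume.restrict (uIoc a b)) atTop hmeas ?_
      rw [huIoc]
      filter_upwards [ae_restrict_mem measurableSet_Ioc] with t ht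
      exact hlim t (Ioc_subset_Icc_self ht)
    · rw [huIoc]
      filter_upwards [ae_restrict_mem measurableSet_Ioc] with t ht
      exact le_of_tendsto (hlim t (Ioc_subset_Icc_self ht)).norm
        (.of_forall fun n => hbd n t (Ioc_subset_Icc_self ht))
  · have hT1 := intervalIntegral.tendsto_integral_filter_of_dominated_convergence
      (μ := volume) (a := a) (b := b) (l := atTop)
      (F := fun n t => rhs τ lam α β ε F₁ (f t) (ψs n))
      (f := fun t => rhs τ lam α β ε F₁ (f t) ψ) (fun _ => L) (.of_forall hmeas)
      (.of_forall fun n => .of_forall fun t ht => hbd n t (by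
        rw [huIoc] at ht; exact Ioc_subset_Icc_self ht))
      intervalIntegrable_const
      (.of_forall fun t ht => hlim t (by rw [huIoc] at ht; exact Ioc_subset_Icc_self ht))
    have hpt : ∀ t ∈ Icc a b, Tendsto (fun n => ∫ v, f t v * ψs n v) atTop
        (𝓝 (∫ v, f t v * ψ v)) := by
      intro t ht
      have hw : WInt N (f t) := (hB t ht).1.mono (Nat.le_succ N)
      refine tendsto_integral_of_dominated_convergence
        (fun v => |f t v| * ((c + 1) * wt N v)) (fun n => ?_) ?_ (fun n => ?_) ?_
      · exact hw.aestronglyMeasurable.mul (hs1 n).continuous.aestronglyMeasurable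
      · refine (hw.abs.const_mul (c + 1)).congr (.of_forall fun v => ?_)
        ring
      · refine .of_forall fun v => ?_
        rw [norm_mul, Real.norm_eq_abs]
        exact mul_le_mul_of_nonneg_left (hs3 n v) (abs_nonneg _)
      · exact .of_forall fun v => (hs4 v).const_mul _
    simp only [hFTC] at hT1
    exact tendsto_nhds_unique hT1
      ((hpt b ⟨hab, le_rfl⟩).sub (hpt a ⟨le_rfl, hab⟩))

omit hε0 hε1 h0 h1 hF in
lemma integral_zero_eq_one : ∫ v, f 0 v = 1 := by
  rw [integral_eq_lintegral_of_nonneg_ae (h.nonneg 0 le_rfl)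
    (h.aemeasurable 0 le_rfl).aestronglyMeasurable, h.mass, ENNReal.toReal_one]

/-- Both collision averages vanish on the constant test function, which the extended weak
formulation admits. -/
lemma integral_eq_one {t : ℝ} (ht : 0 ≤ t) : ∫ v, f t v = 1 := by
  obtain ⟨B, hB⟩ := h.exists_bound_three (T := t + 1) (by linarith)
  have := (h.weak_form hε0 hε1 h0 h1 hF (N := 2) (B := B) le_rfl ht
    (fun s hs => hB s ⟨hs.1, by linarith [hs.2]⟩)
    (hasGrowth_one.mono (Nat.zero_le 2)) continuous_const).2
  have hz : ∀ t, rhs τ lam α β ε F₁ (f t) (fun _ => 1) = 0 := by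
    intro t
    simp [rhs, weakQ, weakL, collA, collJ, sphereAvg]
  simp only [hz, intervalIntegral.integral_zero, mul_one, h.integral_zero_eq_one] at this
  linarith

end weak

end IsSolution

/-! ### Comparison for the integrated differential inequality -/

/-- The right-hand side of the differential inequality for the moments. -/
noncomputable def odeRhs (C A K p x : ℝ) : ℝ := C + A * x - K * x ^ p

lemma continuous_odeRhs (C A K : ℝ) {p : ℝ} (hp : 0 ≤ p) : Continuous (odeRhs C A K p) := by
  have := Real.continuous_rpow_const hp
  unfold odeRhs
  fun_prop

section comparison
variable {y Φ : ℝ → ℝ} {a b : ℝ}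

/-- The integrated inequality bounds the right slopes of `y` near `x` by any number above `Φ (y x)`,
so `y` need not be differentiable. The barrier only has to be a strict supersolution at points of
contact. -/
lemma le_of_sub_le_integral (hy : ContinuousOn y (Icc a b)) (hΦ : Continuous Φ)
    (H : ∀ s t, a ≤ s → s ≤ t → t ≤ b → y t - y s ≤ ∫ u in s..t, Φ (y u))
    {B B' : ℝ → ℝ} (ha : y a ≤ B a) (hB : ContinuousOn B (Icc a b))
    (hB' : ∀ x ∈ Ico a b, HasDerivWithinAt B (B' x) (Ici x) x)
    (bound : ∀ x ∈ Ico a b, y x = B x → Φ (B x) < B' x) :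
    ∀ x ∈ Icc a b, y x ≤ B x := by
  refine image_le_of_liminf_slope_right_lt_deriv_boundary' (f' := fun x => Φ (y x)) hy ?_ ha hB
    hB' fun x hx hxB => by simpa [hxB] using bound x hx hxB
  intro x hx r hr
  obtain ⟨r', hr1, hr2⟩ := exists_between hr
  have hc : ContinuousWithinAt (fun u => Φ (y u)) (Icc a b) x :=
    (hΦ.comp_continuousOn hy) x (Ico_subset_Icc_self hx)
  have hc' : ∀ᶠ u in 𝓝[≥] x, Φ (y u) < r' := by
    refine (hc.mono_of_mem_nhdsWithin ?_).eventually_lt_const hr1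
    exact mem_of_superset (Icc_mem_nhdsGE hx.2) (Icc_subset_Icc_left hx.1)
  obtain ⟨u, hu, hus⟩ := mem_nhdsGE_iff_exists_Ico_subset.1 hc'
  have hxu : x < u := hu
  refine Eventually.frequently ?_
  filter_upwards [Ioo_mem_nhdsGT (lt_min hxu hx.2)] with z hz
  have hzb : z ≤ b := (hz.2.trans_le (min_le_right _ _)).le
  have hzu : z < u := hz.2.trans_le (min_le_left _ _)
  have hint : IntervalIntegrable (fun u => Φ (y u)) volume x z := by
    refine ContinuousOn.intervalIntegrable_of_Icc hz.1.le ?_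
    exact (hΦ.comp_continuousOn hy).mono (Icc_subset_Icc hx.1 hzb)
  have h1 : ∫ u in x..z, Φ (y u) ≤ ∫ u in x..z, r' :=
    intervalIntegral.integral_mono_on hz.1.le hint intervalIntegrable_const fun v hv =>
      (hus ⟨hv.1, hv.2.trans_lt hzu⟩).le
  rw [intervalIntegral.integral_const, smul_eq_mul] at h1
  have h2 := H x z hx.1 hz.1.le hzb
  rw [slope_def_field, div_lt_iff₀ (sub_pos.2 hz.1)]
  have h3 := mul_lt_mul_of_pos_right hr2 (sub_pos.2 hz.1)
  linarith

/-- The superlinear term wins for large `x`. The margin `2 r x` is what the barrier `c d^(-2r)`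
needs, its derivative being `-2r c d^(-2r-1)`; the constant barrier needs only the sign. -/
lemma exists_odeRhs_neg (C A : ℝ) {K r : ℝ} (hC : 0 ≤ C) (hK : 0 < K)
    (hr : 1 ≤ r) :
    ∃ c, 1 ≤ c ∧ ∀ x, c ≤ x → odeRhs C A K (1 + 1 / (2 * r)) x < -(2 * r * x) := by
  have h1 : Tendsto (fun x : ℝ => K * x ^ (1 / (2 * r))) atTop atTop :=
    (tendsto_rpow_atTop (by positivity)).const_mul_atTop hK
  obtain ⟨c, hc⟩ := eventually_atTop.1 (h1.eventually_gt_atTop (C + A + 2 * r))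
  refine ⟨max 1 c, le_max_left _ _, fun x hx => ?_⟩
  have hx1 : 1 ≤ x := (le_max_left _ _).trans hx
  have h2 := mul_lt_mul_of_pos_right (hc x ((le_max_right _ _).trans hx)) (by linarith : 0 < x)
  rw [odeRhs, Real.rpow_add (by linarith), Real.rpow_one]
  have h3 := mul_le_mul_of_nonneg_left hx1 hC
  linarith

variable {C A K r c : ℝ}

lemma le_const_of_sub_le_integral (hr : 1 ≤ r) (hy : ContinuousOn y (Icc a b))
    (hc1 : 1 ≤ c)
    (hc : ∀ x, c ≤ x → odeRhs C A K (1 + 1 / (2 * r)) x < -(2 * r * x))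
    (H : ∀ s t, a ≤ s → s ≤ t → t ≤ b →
      y t - y s ≤ ∫ u in s..t, odeRhs C A K (1 + 1 / (2 * r)) (y u))
    {L : ℝ} (hL : y a ≤ L) (hcL : c ≤ L) : ∀ x ∈ Icc a b, y x ≤ L := by
  refine le_of_sub_le_integral hy (continuous_odeRhs C A K (by positivity)) H
    (B := fun _ => L) (B' := fun _ => 0) hL continuousOn_const
    (fun x _ => hasDerivWithinAt_const _ _ _) fun x _ _ => ?_
  refine (hc L hcL).trans_le ?_
  have : 0 ≤ 2 * r * L := by
    have : 0 ≤ L := by linarith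
    positivity
  linarith

/-- The bound does not involve `y a`, because the barrier is infinite at `a`. This uniformity is
what permits the removal of the truncation when the initial moment is infinite. -/
lemma le_rpow_of_sub_le_integral (hC : 0 ≤ C) (hA : 0 ≤ A) (hr : 1 ≤ r)
    (hab : a < b) (hab1 : b ≤ a + 1) (hy : ContinuousOn y (Icc a b))
    (hc1 : 1 ≤ c)
    (hc : ∀ x, c ≤ x → odeRhs C A K (1 + 1 / (2 * r)) x < -(2 * r * x))
    (H : ∀ s t, a ≤ s → s ≤ t → t ≤ b →
      y t - y s ≤ ∫ u in s..t, odeRhs C A K (1 + 1 / (2 * r)) (y u)) :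
    y b ≤ c * (b - a) ^ (-(2 * r)) := by
  have hc0 : 0 < c := by linarith
  -- close to `a` the comparison function exceeds `y`
  obtain ⟨s, hs, hys⟩ : ∃ s ∈ Ioo a b, y s ≤ c * (s - a) ^ (-(2 * r)) := by
    have h1 : Tendsto (fun s => s - a) (𝓝[>] a) (𝓝[>] 0) := by
      refine tendsto_nhdsWithin_iff.2 ⟨?_, ?_⟩
      · have : Tendsto (fun s => s - a) (𝓝 a) (𝓝 (a - a)) :=
          (continuous_id.sub continuous_const).tendsto a
        rw [sub_self] at this
        exact this.mono_left nhdsWithin_le_nhds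
      · filter_upwards [self_mem_nhdsWithin] with s hs
        have hs' : a < s := hs
        exact sub_pos.2 hs'
    have h2 : Tendsto (fun s => c * (s - a) ^ (-(2 * r))) (𝓝[>] a) atTop :=
      ((tendsto_rpow_neg_nhdsGT_zero (by linarith : -(2 * r) < 0)).comp h1).const_mul_atTop hc0
    have h3 : ∀ᶠ s in 𝓝[>] a, y s < y a + 1 := by
      have : ContinuousWithinAt y (Ioi a) a :=
        (hy a (left_mem_Icc.2 hab.le)).mono_of_mem_nhdsWithin (Icc_mem_nhdsGT hab)
      exact this.eventually_lt_const (by linarith)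
    obtain ⟨s, h4, h5, h6⟩ := ((h2.eventually_ge_atTop (y a + 1)).and
      (h3.and (Ioo_mem_nhdsGT hab))).exists
    exact ⟨s, h6, h5.le.trans h4⟩
  have hpos : ∀ x ∈ Icc s b, 0 < x - a := fun x hx => by linarith [hs.1, hx.1]
  have hderiv : ∀ x ∈ Icc s b, HasDerivAt (fun x => c * (x - a) ^ (-(2 * r)))
      (c * (-(2 * r) * (x - a) ^ (-(2 * r) - 1))) x := by
    intro x hx
    have := (((hasDerivAt_id x).sub_const a).rpow_const (p := -(2 * r))
      (.inl (hpos x hx).ne')).const_mul c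
    simpa using this
  refine le_of_sub_le_integral (hy.mono (Icc_subset_Icc_left hs.1.le))
    (continuous_odeRhs C A K (by positivity))
    (fun u v hu huv hv => H u v (hs.1.le.trans hu) huv hv)
    (B := fun x => c * (x - a) ^ (-(2 * r)))
    (B' := fun x => c * (-(2 * r) * (x - a) ^ (-(2 * r) - 1))) hys
    (fun x hx => (hderiv x hx).continuousAt.continuousWithinAt)
    (fun x hx => (hderiv x (Ico_subset_Icc_self hx)).hasDerivWithinAt)
    (fun x hx _ => ?_) b (right_mem_Icc.2 hs.2.le)
  set d := x - a with hd
  have hd0 : 0 < d := hpos x (Ico_subset_Icc_self hx)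
  have hd1 : d ≤ 1 := by linarith [hx.2]
  -- The exponents match: the damping of the barrier scales like its derivative. Since `d ≤ 1`, the
  -- lower order terms are dominated by the same power, and the claim reduces to the choice of `c`
  -- at `d = 1`.
  have e1 : (d ^ (-(2 * r))) ^ (1 + 1 / (2 * r)) = d ^ (-(2 * r) - 1) := by
    rw [← Real.rpow_mul hd0.le]
    congr 1
    field_simp
    ring
  have e2 : d ^ (-(2 * r)) ≤ d ^ (-(2 * r) - 1) :=
    Real.rpow_le_rpow_of_exponent_ge hd0 hd1 (by linarith)
  have e3 : 1 ≤ d ^ (-(2 * r) - 1) :=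
    Real.one_le_rpow_of_pos_of_le_one_of_nonpos hd0 hd1 (by linarith)
  have e4 := hc c le_rfl
  rw [odeRhs] at e4 ⊢
  rw [Real.mul_rpow hc0.le (by positivity), e1]
  have h5 := mul_le_mul_of_nonneg_left e2 (mul_nonneg hA hc0.le)
  have h6 := mul_le_mul_of_nonneg_left e3 hC
  have h7 := mul_lt_mul_of_pos_right e4 (by positivity : 0 < d ^ (-(2 * r) - 1))
  nlinarith

end comparison

/-! ### Truncated moments and true moments -/

lemma hasGrowth_truncPow {r n : ℝ} (hr : 1 ≤ r) (hn : 1 ≤ n) :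
    HasGrowth 2 fun v => truncPow r n (‖v‖ ^ 2) := by
  have hp := isPowerLike_truncPow hr hn
  refine ⟨(continuous_comp_norm_sq hp).stronglyMeasurable, n ^ (r - 1), by positivity,
    fun v => ?_⟩
  rw [abs_of_nonneg (hp.nonneg _ (sq_nonneg _))]
  refine (truncPow_le_mul hr (sq_nonneg _) (by linarith)).trans ?_
  refine mul_le_mul_of_nonneg_left ?_ (by positivity)
  exact pow_le_pow_left₀ (norm_nonneg v) (by simp) 2

section moments
variable {g : Vel → ℝ}

lemma IsDistribution.integral_eq_one (h : IsDistribution g) : ∫ v, g v = 1 := by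
  rw [integral_eq_lintegral_of_nonneg_ae h.nonneg h.aemeasurable.aestronglyMeasurable, h.mass,
    ENNReal.toReal_one]

lemma moment_eq_ofReal {N : ℕ} {s : ℝ} (hs : 0 ≤ s) (hN : 2 * s ≤ N)
    (hg : WInt N g) (hg0 : ∀ᵐ v, 0 ≤ g v) :
    moment g s = ENNReal.ofReal (∫ v, g v * ‖v‖ ^ (2 * s)) := by
  have hgr := (hasGrowth_norm_rpow (s := 2 * s) (by linarith)).mono (Nat.ceil_le.2 hN)
  refine (ofReal_integral_eq_lintegral_ofReal (hg.integrable hgr) ?_).symm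
  filter_upwards [hg0] with v hv
  positivity

lemma wt_le_mul_one_add (N : ℕ) (v : Vel) :
    wt N v ≤ 2 ^ N * (1 + ‖v‖ ^ (2 * ((N : ℝ) + 1))) := by
  have h2 : (1 + ‖v‖) ≤ 2 * max 1 ‖v‖ := by
    linarith [le_max_left 1 ‖v‖, le_max_right 1 ‖v‖]
  have h3 : (max 1 ‖v‖) ^ N ≤ 1 + ‖v‖ ^ (2 * ((N : ℝ) + 1)) := by
    rcases le_total 1 ‖v‖ with h | h
    · rw [max_eq_right h, ← Real.rpow_natCast]
      have := Real.rpow_le_rpow_of_exponent_le h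
        (by have : (0 : ℝ) ≤ N := N.cast_nonneg
            linarith : (N : ℝ) ≤ 2 * ((N : ℝ) + 1))
      linarith
    · rw [max_eq_left h, one_pow]
      have : 0 ≤ ‖v‖ ^ (2 * ((N : ℝ) + 1)) := by positivity
      linarith
  calc wt N v ≤ (2 * max 1 ‖v‖) ^ N := pow_le_pow_left₀ (by positivity) h2 N
    _ = 2 ^ N * (max 1 ‖v‖) ^ N := mul_pow _ _ _
    _ ≤ _ := mul_le_mul_of_nonneg_left h3 (by positivity)

/-- The order `N + 1` is generous, but it is always at least `1`, the range in which creation of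
moments is available. -/
lemma lintegral_wt_le_moment (N : ℕ) (hm : AEMeasurable g) (hg0 : ∀ᵐ v, 0 ≤ g v)
    (hmass : ∫⁻ v, ENNReal.ofReal (g v) = 1) :
    ∫⁻ v, ENNReal.ofReal (|g v| * wt N v) ≤
      ENNReal.ofReal (2 ^ N) * (1 + moment g ((N : ℝ) + 1)) := by
  rw [← hmass, moment, ← lintegral_add_left' hm.ennreal_ofReal,
    ← lintegral_const_mul' _ _ ENNReal.ofReal_ne_top]
  refine lintegral_mono_ae ?_
  filter_upwards [hg0] with v hv
  rw [← ENNReal.ofReal_add hv (by positivity), ← ENNReal.ofReal_mul (by positivity),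
    abs_of_nonneg hv]
  refine ENNReal.ofReal_le_ofReal ?_
  have := mul_le_mul_of_nonneg_left (wt_le_mul_one_add N v) hv
  linarith

lemma wInt_of_moment (N : ℕ) (hm : AEMeasurable g) (hg0 : ∀ᵐ v, 0 ≤ g v)
    (hmass : ∫⁻ v, ENNReal.ofReal (g v) = 1) {L : ℝ} (hL : 0 ≤ L)
    (h : moment g ((N : ℝ) + 1) ≤ ENNReal.ofReal L) :
    WInt N g ∧ ∫ v, |g v| * wt N v ≤ 2 ^ N * (1 + L) := by
  have h1 : ∫⁻ v, ENNReal.ofReal (|g v| * wt N v) ≤ ENNReal.ofReal (2 ^ N * (1 + L)) := by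
    refine (lintegral_wt_le_moment N hm hg0 hmass).trans ?_
    rw [ENNReal.ofReal_mul (by positivity), ENNReal.ofReal_add zero_le_one hL,
      ENNReal.ofReal_one]
    gcongr
  rw [wInt_iff hm, integral_abs_mul_wt hm]
  exact ⟨h1.trans_lt ENNReal.ofReal_lt_top, ENNReal.toReal_le_of_le_ofReal (by positivity) h1⟩

/-- On the ball of radius `m` the truncation at level `m² + 1` is inactive; the balls then exhaust
the space. -/
lemma moment_le_of_forall_truncPow {r L : ℝ} (hr : 1 ≤ r) (hg : WInt 2 g)
    (hg0 : ∀ᵐ v, 0 ≤ g v)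
    (h : ∀ n : ℝ, 1 ≤ n → ∫ v, g v * truncPow r n (‖v‖ ^ 2) ≤ L) :
    moment g r ≤ ENNReal.ofReal L := by
  refine lintegral_le_of_forall_ball fun m => ?_
  set n : ℝ := (m : ℝ) ^ 2 + 1
  have hn : 1 ≤ n := by simp only [n]; nlinarith [sq_nonneg (m : ℝ)]
  have hp := isPowerLike_truncPow hr hn
  have hgr := hasGrowth_truncPow hr hn
  have hnn : ∀ᵐ v, 0 ≤ g v * truncPow r n (‖v‖ ^ 2) := by
    filter_upwards [hg0] with v hv
    exact mul_nonneg hv (hp.nonneg _ (sq_nonneg _))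
  refine le_trans ?_ (ENNReal.ofReal_le_ofReal (h n hn))
  rw [ofReal_integral_eq_lintegral_ofReal (hg.integrable hgr) hnn]
  refine le_trans (setLIntegral_mono' Metric.isClosed_closedBall.measurableSet fun v hv => ?_)
    (setLIntegral_le_lintegral _ _)
  rw [mem_closedBall_zero_iff] at hv
  rw [truncPow_eq_rpow hr (sq_nonneg _), Real.rpow_mul (norm_nonneg v), Real.rpow_two]
  have : ‖v‖ ^ 2 ≤ (m : ℝ) ^ 2 := pow_le_pow_left₀ (norm_nonneg v) hv 2
  simp only [n]
  linarith

end moments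

/-! ### Interpolation between weights and differentiation in time -/

/-- Convergence in a weighted `L¹` space from convergence with a smaller weight and a bound with
a larger weight. -/
lemma tendsto_wt_of_bound {ι : Type*} {l : Filter ι} {gs : ι → Vel → ℝ} {M N : ℕ} {B : ℝ}
    (hM : ∀ᶠ i in l, WInt M (gs i)) (hN : ∀ᶠ i in l, WInt (N + 1) (gs i))
    (hB : ∀ᶠ i in l, ∫ v, |gs i v| * wt (N + 1) v ≤ B)
    (hl : Tendsto (fun i => ∫ v, |gs i v| * wt M v) l (𝓝 0)) :
    Tendsto (fun i => ∫ v, |gs i v| * wt N v) l (𝓝 0) := by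
  have hnn : ∀ (P : ℕ) i, 0 ≤ ∫ v, |gs i v| * wt P v := fun P i =>
    integral_nonneg fun v => mul_nonneg (abs_nonneg _) (wt_pos _ _).le
  refine tendsto_order.2 ⟨fun a ha => .of_forall fun i => ha.trans_le (hnn N i), fun e he => ?_⟩
  set B' := |B| + 1
  -- With this radius the tail `|v| ≥ R` contributes at most `R⁻¹ B < R⁻¹ B' = e/2`.
  set R : ℝ := 2 * B' / e with hR
  have hB'0 : 0 < B' := by positivity
  have hR0 : 0 < R := by positivity
  have h1 := hl.const_mul ((1 + R) ^ N)
  rw [mul_zero] at h1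
  filter_upwards [hM, hN, hB, h1.eventually_lt_const (half_pos he)] with i h2 h3 h4 h5
  have hpt : ∀ v, wt N v ≤ (1 + R) ^ N * wt M v + R⁻¹ * wt (N + 1) v := by
    intro v
    have hw := wt_pos N v
    rcases le_total ‖v‖ R with hv | hv
    · have e1 : wt N v ≤ (1 + R) ^ N := pow_le_pow_left₀ (by positivity) (by linarith) N
      have e2 := le_mul_of_one_le_right (by positivity : 0 ≤ (1 + R) ^ N) (one_le_wt M v)
      have e3 : 0 ≤ R⁻¹ * wt (N + 1) v := mul_nonneg (by positivity) (wt_pos _ _).le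
      linarith
    · have e1 : wt N v ≤ R⁻¹ * wt (N + 1) v := by
        rw [wt_succ, ← div_eq_inv_mul, le_div_iff₀ hR0]
        exact mul_le_mul_of_nonneg_left (by linarith) hw.le
      have e3 : 0 ≤ (1 + R) ^ N * wt M v := mul_nonneg (by positivity) (wt_pos _ _).le
      linarith
  have hle : ∫ v, |gs i v| * wt N v ≤
      (1 + R) ^ N * (∫ v, |gs i v| * wt M v) + R⁻¹ * ∫ v, |gs i v| * wt (N + 1) v := by
    rw [← integral_const_mul, ← integral_const_mul,
      ← integral_add (h2.abs.const_mul _) (h3.abs.const_mul _)]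
    refine integral_mono (h3.mono (Nat.le_succ N)).abs
      ((h2.abs.const_mul _).add (h3.abs.const_mul _)) fun v => ?_
    have := mul_le_mul_of_nonneg_left (hpt v) (abs_nonneg (gs i v))
    change |gs i v| * wt N v ≤
      (1 + R) ^ N * (|gs i v| * wt M v) + R⁻¹ * (|gs i v| * wt (N + 1) v)
    linarith
  have h6 : R⁻¹ * ∫ v, |gs i v| * wt (N + 1) v < e / 2 := by
    rw [← div_eq_inv_mul, div_lt_iff₀ hR0]
    have : e / 2 * R = B' := by rw [hR]; field_simp
    rw [this]
    have := le_abs_self B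
    simp only [B']
    linarith
  linarith

namespace IsSolution
variable {τ lam α β ε : ℝ} {F₁ : Vel → ℝ} {f : ℝ → Vel → ℝ}
variable (h : IsSolution τ lam α β ε F₁ f) (hε0 : 0 ≤ ε) (hε1 : ε ≤ 1)
  (h0 : 0 ≤ α * (1 - β)) (h1 : α * (1 - β) ≤ 1) (hF : ∀ N, WInt N F₁)
include h hε0 hε1 h0 h1 hF

lemma mass_eq_one {t : ℝ} (ht : 0 ≤ t) : ∫⁻ v, ENNReal.ofReal (f t v) = 1 := by
  have h2 : Integrable (f t) := by
    simpa using (h.wInt_two ht).integrable (hasGrowth_one.mono (Nat.zero_le _))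
  rw [← ofReal_integral_eq_lintegral_ofReal h2 (h.nonneg t ht),
    h.integral_eq_one hε0 hε1 h0 h1 hF ht, ENNReal.ofReal_one]

lemma sub_le_integral {C A K p : ℝ} (hp : 0 ≤ p) {ψ : Vel → ℝ} (hψ : HasGrowth 2 ψ)
    (hcont : Continuous ψ)
    (hrhs : ∀ t, 0 ≤ t → WInt 3 (f t) →
      rhs τ lam α β ε F₁ (f t) ψ ≤ odeRhs C A K p (∫ v, f t v * ψ v))
    {s t : ℝ} (hs : 0 ≤ s) (hst : s ≤ t) :
    (∫ v, f t v * ψ v) - (∫ v, f s v * ψ v) ≤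
      ∫ u in s..t, odeRhs C A K p (∫ v, f u v * ψ v) := by
  obtain ⟨B, hB⟩ := h.exists_bound_three (T := t + 1) (by linarith)
  have hB' : ∀ u ∈ Icc s t, WInt 3 (f u) ∧ ∫ v, |f u v| * wt 3 v ≤ B := fun u hu =>
    hB u ⟨hs.trans hu.1, by linarith [hu.2]⟩
  obtain ⟨hi, he⟩ := h.weak_form hε0 hε1 h0 h1 hF hs hst hB' hψ hcont
  rw [← he]
  refine intervalIntegral.integral_mono_on hst hi ?_ fun u hu =>
    hrhs u (hs.trans hu.1) (hB' u hu).1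
  refine ContinuousOn.intervalIntegrable_of_Icc hst ?_
  exact (continuous_odeRhs C A K hp).comp_continuousOn
    ((h.continuousOn_integral hψ).mono fun u hu => hs.trans hu.1)

/-- A solution of finite weighted norms on `(0,∞)` has differentiable moments there. -/
lemma hasDerivAt_integral {N : ℕ} (hw : ∀ δ, 0 < δ → ∃ B, ∀ t, δ ≤ t →
      WInt (N + 2) (f t) ∧ ∫ v, |f t v| * wt (N + 2) v ≤ B)
    {ψ : Vel → ℝ} (hψ : HasGrowth N ψ) (hcont : Continuous ψ) {t : ℝ} (ht : 0 < t) :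
    HasDerivAt (fun s => ∫ v, f s v * ψ v) (rhs τ lam α β ε F₁ (f t) ψ) t := by
  have hwt : ∀ t, 0 < t → WInt (N + 1) (f t) := fun t ht => by
    obtain ⟨B, hB⟩ := hw t ht
    exact (hB t le_rfl).1.mono (by omega)
  -- Continuity of the right-hand side requires convergence with weight `N + 1`, obtained by
  -- interpolating the given convergence with weight `2` against the bound with weight `N + 2`.
  have hrc : ∀ t, 0 < t → ContinuousAt (fun s => rhs τ lam α β ε F₁ (f s) ψ) t := by
    intro t ht
    obtain ⟨B, hB⟩ := hw (t / 2) (by linarith)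
    have hev : ∀ᶠ s in 𝓝 t, t / 2 < s := lt_mem_nhds (by linarith)
    refine tendsto_rhs hε0 hε1 h0 h1 (hF (N + 1)) ?_ (hwt t ht) ?_ hψ hcont
    · filter_upwards [hev] with s hs
      exact hwt s (by linarith)
    · refine tendsto_wt_of_bound (M := 2) (B := B + B) ?_ ?_ ?_ ?_
      · filter_upwards [hev] with s hs
        exact (h.wInt_two (by linarith)).sub (h.wInt_two ht.le)
      · filter_upwards [hev] with s hs
        exact (hB s hs.le).1.sub (hB t (by linarith)).1
      · filter_upwards [hev] with s hs
        refine le_trans ?_ (add_le_add (hB s hs.le).2 (hB t (by linarith)).2)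
        rw [← integral_add (hB s hs.le).1.abs (hB t (by linarith)).1.abs]
        refine integral_mono ((hB s hs.le).1.sub (hB t (by linarith)).1).abs
          ((hB s hs.le).1.abs.add (hB t (by linarith)).1.abs) fun v => ?_
        change |f s v - f t v| * wt (N + 2) v ≤
          |f s v| * wt (N + 2) v + |f t v| * wt (N + 2) v
        rw [← add_mul]
        exact mul_le_mul_of_nonneg_right (abs_sub _ _) (wt_pos _ _).le
      · have := h.tendsto_two ht.le
        rwa [nhdsWithin_eq_nhds.2 (Ici_mem_nhds ht)] at this
  have ha : 0 < t / 2 := by linarith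
  obtain ⟨B, hB⟩ := hw (t / 2) ha
  obtain ⟨B', hB'⟩ : ∃ B', ∀ s, t / 2 ≤ s →
      WInt (N + 1) (f s) ∧ ∫ v, |f s v| * wt (N + 1) v ≤ B' := by
    refine ⟨B, fun s hs => ⟨(hB s hs).1.mono (by omega), le_trans ?_ (hB s hs).2⟩⟩
    refine integral_mono ((hB s hs).1.mono (by omega)).abs (hB s hs).1.abs fun v => ?_
    exact mul_le_mul_of_nonneg_left (wt_mono (by omega) v) (abs_nonneg _)
  have hcOn : ContinuousOn (fun s => rhs τ lam α β ε F₁ (f s) ψ) (Ioi 0) := fun s hs =>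
    (hrc s hs).continuousWithinAt
  have hint : IntervalIntegrable (fun s => rhs τ lam α β ε F₁ (f s) ψ) volume (t / 2) t :=
    ContinuousOn.intervalIntegrable_of_Icc (by linarith)
      (hcOn.mono fun s hs => lt_of_lt_of_le ha hs.1)
  have hd := intervalIntegral.integral_hasDerivAt_right hint
    (hcOn.stronglyMeasurableAtFilter isOpen_Ioi t ht) (hrc t ht)
  refine (hd.add_const (∫ v, f (t / 2) v * ψ v)).congr_of_eventuallyEq ?_
  filter_upwards [lt_mem_nhds (show t / 2 < t by linarith)] with s hs
  rw [(h.weak_form hε0 hε1 h0 h1 hF ha.le hs.le (fun u hu => hB' u hu.1) hψ hcont).2]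
  ring

end IsSolution

/-! ### Propagation, creation and regularity of moments -/

lemma integral_truncPow_le_moment {r n : ℝ} {g : Vel → ℝ} (hr : 1 ≤ r) (hn : 1 ≤ n)
    (hg : WInt 2 g) (hg0 : ∀ᵐ v, 0 ≤ g v) :
    ENNReal.ofReal (∫ v, g v * truncPow r n (‖v‖ ^ 2)) ≤ moment g r := by
  have hp := isPowerLike_truncPow hr hn
  rw [ofReal_integral_eq_lintegral_ofReal (hg.integrable (hasGrowth_truncPow hr hn))]
  · refine lintegral_mono_ae ?_
    filter_upwards [hg0] with v hv
    refine ENNReal.ofReal_le_ofReal (mul_le_mul_of_nonneg_left ?_ hv)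
    have := hp.le_rpow _ (sq_nonneg ‖v‖)
    rwa [← Real.rpow_two, ← Real.rpow_mul (norm_nonneg v), Real.rpow_two] at this
  · filter_upwards [hg0] with v hv
    exact mul_nonneg hv (hp.nonneg _ (sq_nonneg _))

lemma exists_lt_integral_truncPow {r a : ℝ} {g : Vel → ℝ} (hr : 1 ≤ r)
    (hg : WInt 2 g) (hg0 : ∀ᵐ v, 0 ≤ g v) (ha : a < (moment g r).toReal) :
    ∃ n, 1 ≤ n ∧ a < ∫ v, g v * truncPow r n (‖v‖ ^ 2) := by
  by_contra! hcon
  have h1 : 0 ≤ a := by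
    refine le_trans (integral_nonneg_of_ae ?_) (hcon 1 le_rfl)
    filter_upwards [hg0] with v hv
    exact mul_nonneg hv ((isPowerLike_truncPow hr le_rfl).nonneg _ (sq_nonneg _))
  exact ha.not_ge (ENNReal.toReal_le_of_le_ofReal h1
    (moment_le_of_forall_truncPow hr hg hg0 hcon))

lemma host_moments {F₁ : Vel → ℝ} {M : ℝ → ℝ≥0} (hF : IsDistribution F₁)
    (hM : ∀ s, 0 ≤ s → moment F₁ s = (M s : ℝ≥0∞)) :
    (∀ N, WInt N F₁) ∧ ∀ s, 0 ≤ s → ∫ v, F₁ v * ‖v‖ ^ (2 * s) = M s := by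
  have hW : ∀ N, WInt N F₁ := fun N =>
    (wInt_of_moment N hF.aemeasurable hF.nonneg hF.mass
      (L := M ((N : ℝ) + 1)) NNReal.zero_le_coe (by rw [hM _ (by positivity)]; simp)).1
  refine ⟨hW, fun s hs => ?_⟩
  have h1 := hM s hs
  rw [moment_eq_ofReal hs (Nat.le_ceil _) (hW ⌈2 * s⌉₊) hF.nonneg] at h1
  have h2 : 0 ≤ ∫ v, F₁ v * ‖v‖ ^ (2 * s) := by
    refine integral_nonneg_of_ae ?_
    filter_upwards [hF.nonneg] with v hv
    positivity
  have := congrArg ENNReal.toReal h1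
  rwa [ENNReal.toReal_ofReal h2, ENNReal.coe_toReal] at this

/-- The collision operators satisfy the moment inequality of order `r` along `f`, with constants
`C`, `A`, `K`. -/
def MomentIneq (τ lam α β ε : ℝ) (F₁ : Vel → ℝ) (f : ℝ → Vel → ℝ) (r C A K : ℝ) : Prop :=
  ∀ (φ : ℝ → ℝ) (N : ℕ), 1 ≤ N → IsPowerLike r φ → HasGrowth N (fun v => φ (‖v‖ ^ 2)) →
    ∀ t, 0 ≤ t → WInt (N + 1) (f t) →
      rhs τ lam α β ε F₁ (f t) (fun v => φ (‖v‖ ^ 2)) ≤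
        odeRhs C A K (1 + 1 / (2 * r)) (∫ v, f t v * φ (‖v‖ ^ 2))

namespace IsSolution
variable {τ lam α β ε : ℝ} {F₁ : Vel → ℝ} {f : ℝ → Vel → ℝ} {r C A K c : ℝ}
variable (h : IsSolution τ lam α β ε F₁ f) (hε0 : 0 ≤ ε) (hε1 : ε ≤ 1)
  (h0 : 0 ≤ α * (1 - β)) (h1 : α * (1 - β) ≤ 1) (hF : ∀ N, WInt N F₁)
  (hr : 1 ≤ r) (hI : MomentIneq τ lam α β ε F₁ f r C A K)
include h hε0 hε1 h0 h1 hF hr hI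

lemma truncPow_sub_le_integral {n : ℝ} (hn : 1 ≤ n) {s t : ℝ} (hs : 0 ≤ s) (hst : s ≤ t) :
    (∫ v, f t v * truncPow r n (‖v‖ ^ 2)) - (∫ v, f s v * truncPow r n (‖v‖ ^ 2)) ≤
      ∫ u in s..t, odeRhs C A K (1 + 1 / (2 * r)) (∫ v, f u v * truncPow r n (‖v‖ ^ 2)) :=
  h.sub_le_integral hε0 hε1 h0 h1 hF (by positivity) (hasGrowth_truncPow hr hn)
    (continuous_comp_norm_sq (isPowerLike_truncPow hr hn))
    (hI _ 2 (by norm_num) (isPowerLike_truncPow hr hn) (hasGrowth_truncPow hr hn)) hs hst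

/-- Propagation of moments. -/
lemma truncPow_le_max (hc1 : 1 ≤ c)
    (hc : ∀ x, c ≤ x → odeRhs C A K (1 + 1 / (2 * r)) x < -(2 * r * x)) {L : ℝ} (hcL : c ≤ L)
    (hL : moment (f 0) r ≤ ENNReal.ofReal L) {n : ℝ} (hn : 1 ≤ n) {t : ℝ} (ht : 0 ≤ t) :
    ∫ v, f t v * truncPow r n (‖v‖ ^ 2) ≤ L := by
  refine le_const_of_sub_le_integral hr (a := 0) (b := t)
    (y := fun t => ∫ v, f t v * truncPow r n (‖v‖ ^ 2))
    ((h.continuousOn_integral (hasGrowth_truncPow hr hn)).mono fun s hs => hs.1) hc1 hc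
    (fun s u hs hsu _ => h.truncPow_sub_le_integral hε0 hε1 h0 h1 hF hr hI hn hs hsu)
    ?_ hcL t ⟨ht, le_rfl⟩
  have h2 := (integral_truncPow_le_moment hr hn (h.wInt_two le_rfl) (h.nonneg 0 le_rfl)).trans hL
  exact (ENNReal.ofReal_le_ofReal_iff (by linarith)).1 h2

lemma moment_le_of_moment_zero_le (hc1 : 1 ≤ c)
    (hc : ∀ x, c ≤ x → odeRhs C A K (1 + 1 / (2 * r)) x < -(2 * r * x)) {L : ℝ} (hcL : c ≤ L)
    (hL : moment (f 0) r ≤ ENNReal.ofReal L) {t : ℝ} (ht : 0 ≤ t) :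
    moment (f t) r ≤ ENNReal.ofReal L :=
  moment_le_of_forall_truncPow hr (h.wInt_two ht) (h.nonneg t ht) fun _ hn =>
    h.truncPow_le_max hε0 hε1 h0 h1 hF hr hI hc1 hc hcL hL hn ht

/-- Creation of moments. -/
lemma moment_le_rpow (hC : 0 ≤ C) (hA : 0 ≤ A) (hc1 : 1 ≤ c)
    (hc : ∀ x, c ≤ x → odeRhs C A K (1 + 1 / (2 * r)) x < -(2 * r * x)) {t : ℝ} (ht : 0 < t) :
    moment (f t) r ≤ ENNReal.ofReal (c * (min t 1) ^ (-(2 * r))) := by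
  refine moment_le_of_forall_truncPow hr (h.wInt_two ht.le) (h.nonneg t ht.le) fun n hn => ?_
  -- The comparison is run on a window of length `min t 1` ending at `t`; restarting it at a later
  -- time makes the bound uniform for `t ≥ 1`.
  have hm : 0 < min t 1 := lt_min ht one_pos
  have hs0 : 0 ≤ t - min t 1 := sub_nonneg.2 (min_le_left _ _)
  have := le_rpow_of_sub_le_integral hC hA hr (a := t - min t 1) (b := t)
    (y := fun t => ∫ v, f t v * truncPow r n (‖v‖ ^ 2)) (by linarith)
    (by linarith [min_le_right t 1])
    ((h.continuousOn_integral (hasGrowth_truncPow hr hn)).mono fun s hs => hs0.trans hs.1)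
    hc1 hc (fun s u hs hsu _ =>
      h.truncPow_sub_le_integral hε0 hε1 h0 h1 hF hr hI hn (hs0.trans hs) hsu)
  rwa [sub_sub_cancel] at this

/-- Lower semicontinuity holds because the moment is a supremum of continuous truncated moments.
Upper semicontinuity follows from linear growth in time, obtained by dropping the damping term and
inserting the propagated bound `L`. -/
lemma continuousWithinAt_moment_zero (hA : 0 ≤ A) (hK : 0 ≤ K) (hc1 : 1 ≤ c)
    (hc : ∀ x, c ≤ x → odeRhs C A K (1 + 1 / (2 * r)) x < -(2 * r * x))
    (hfin : moment (f 0) r < ∞) :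
    ContinuousWithinAt (fun t => (moment (f t) r).toReal) (Ici 0) 0 := by
  set Y0 := (moment (f 0) r).toReal with hY0
  have hY00 : 0 ≤ Y0 := ENNReal.toReal_nonneg
  set L := max Y0 c
  have hL : moment (f 0) r ≤ ENNReal.ofReal L := by
    rw [← ENNReal.ofReal_toReal hfin.ne]
    exact ENNReal.ofReal_le_ofReal (le_max_left _ _)
  have hLc : c ≤ L := le_max_right _ _
  have hbd : ∀ t, 0 ≤ t → moment (f t) r ≤ ENNReal.ofReal (Y0 + t * |C + A * L|) := by
    intro t ht
    refine moment_le_of_forall_truncPow hr (h.wInt_two ht) (h.nonneg t ht) fun n hn => ?_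
    have h2 := h.truncPow_sub_le_integral hε0 hε1 h0 h1 hF hr hI hn le_rfl ht
    have h3 : ∫ u in (0 : ℝ)..t, odeRhs C A K (1 + 1 / (2 * r))
        (∫ v, f u v * truncPow r n (‖v‖ ^ 2)) ≤ ∫ u in (0 : ℝ)..t, |C + A * L| := by
      refine intervalIntegral.integral_mono_on ht ?_ intervalIntegrable_const fun u hu => ?_
      · refine ContinuousOn.intervalIntegrable_of_Icc ht ?_
        exact (continuous_odeRhs C A K (by positivity)).comp_continuousOn
          ((h.continuousOn_integral (hasGrowth_truncPow hr hn)).mono fun u hu => hu.1)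
      · have h4 := h.truncPow_le_max hε0 hε1 h0 h1 hF hr hI hc1 hc hLc hL hn hu.1
        have h5 : 0 ≤ ∫ v, f u v * truncPow r n (‖v‖ ^ 2) := by
          refine integral_nonneg_of_ae ?_
          filter_upwards [h.nonneg u hu.1] with v hv
          exact mul_nonneg hv ((isPowerLike_truncPow hr hn).nonneg _ (sq_nonneg _))
        have h6 := mul_nonneg hK (Real.rpow_nonneg h5 (1 + 1 / (2 * r)))
        have h7 := mul_le_mul_of_nonneg_left h4 hA
        rw [odeRhs]
        linarith [le_abs_self (C + A * L)]
    rw [intervalIntegral.integral_const, smul_eq_mul, sub_zero] at h3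
    have h8 : ∫ v, f 0 v * truncPow r n (‖v‖ ^ 2) ≤ Y0 := by
      have := integral_truncPow_le_moment hr hn (h.wInt_two le_rfl) (h.nonneg 0 le_rfl)
      rw [← ENNReal.ofReal_toReal hfin.ne] at this
      exact (ENNReal.ofReal_le_ofReal_iff hY00).1 this
    linarith
  refine tendsto_order.2 ⟨fun a ha => ?_, fun a ha => ?_⟩
  · obtain ⟨n, hn, han⟩ := exists_lt_integral_truncPow hr (h.wInt_two le_rfl)
      (h.nonneg 0 le_rfl) ha
    have hev := (h.continuousOn_integral (hasGrowth_truncPow hr hn) 0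
      self_mem_Ici).eventually_const_lt han
    filter_upwards [hev, self_mem_nhdsWithin] with t ht1 ht0
    have hfin' : moment (f t) r ≠ ∞ := ((hbd t ht0).trans_lt ENNReal.ofReal_lt_top).ne
    have := integral_truncPow_le_moment hr hn (h.wInt_two ht0) (h.nonneg t ht0)
    rw [← ENNReal.ofReal_toReal hfin'] at this
    exact ht1.trans_le ((ENNReal.ofReal_le_ofReal_iff ENNReal.toReal_nonneg).1 this)
  · have hlim : Tendsto (fun t => Y0 + t * |C + A * L|) (𝓝[Ici 0] 0) (𝓝 Y0) := by
      have : Continuous fun t => Y0 + t * |C + A * L| := by fun_prop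
      have h2 := this.tendsto 0
      simp only [zero_mul, add_zero] at h2
      exact h2.mono_left nhdsWithin_le_nhds
    filter_upwards [hlim.eventually_lt_const ha, self_mem_nhdsWithin] with t ht ht0
    have ht0' : 0 ≤ t := ht0
    exact (ENNReal.toReal_le_of_le_ofReal (by positivity) (hbd t ht0)).trans_lt ht

-- Creation of moments of all orders bounds every polynomial weight uniformly on `[δ,∞)`, so the
-- full power becomes an admissible test function at positive times.
omit hr hI in
lemma hasDerivAt_moment (hr : 1 ≤ r)
    (hcr : ∀ s, 1 ≤ s → ∃ c, 0 ≤ c ∧ ∀ t, 0 < t →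
      moment (f t) s ≤ ENNReal.ofReal (c * (min t 1) ^ (-(2 * s))))
    {t : ℝ} (ht : 0 < t) :
    HasDerivAt (fun s => (moment (f s) r).toReal)
      (rhs τ lam α β ε F₁ (f t) (fun v => (‖v‖ ^ 2) ^ r)) t := by
  have hw : ∀ (N : ℕ) (δ : ℝ), 0 < δ → ∃ B, ∀ t, δ ≤ t →
      WInt N (f t) ∧ ∫ v, |f t v| * wt N v ≤ B := by
    intro N δ hδ
    obtain ⟨c, hc0, hc⟩ := hcr ((N : ℝ) + 1) (by simp)
    have hm : 0 < min δ 1 := lt_min hδ one_pos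
    refine ⟨2 ^ N * (1 + c * (min δ 1) ^ (-(2 * ((N : ℝ) + 1)))), fun t ht => ?_⟩
    have ht0 : 0 < t := hδ.trans_le ht
    refine wInt_of_moment N (h.aemeasurable t ht0.le) (h.nonneg t ht0.le)
      (h.mass_eq_one hε0 hε1 h0 h1 hF ht0.le)
      (L := c * (min δ 1) ^ (-(2 * ((N : ℝ) + 1)))) (by positivity) ((hc t ht0).trans ?_)
    refine ENNReal.ofReal_le_ofReal (mul_le_mul_of_nonneg_left ?_ hc0)
    refine Real.rpow_le_rpow_of_nonpos hm (min_le_min_right 1 ht) ?_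
    have : (0 : ℝ) ≤ N := N.cast_nonneg
    linarith
  have hφ := isPowerLike_rpow hr
  set N := ⌈2 * r⌉₊
  have hpow : ∀ v : Vel, (‖v‖ ^ 2) ^ r = ‖v‖ ^ (2 * r) := fun v => by
    rw [Real.rpow_mul (norm_nonneg v), Real.rpow_two]
  have hgr : HasGrowth N fun v => (‖v‖ ^ 2) ^ r := by
    simp only [hpow]
    exact hasGrowth_norm_rpow (by linarith)
  refine (h.hasDerivAt_integral hε0 hε1 h0 h1 hF (hw (N + 2)) hgr
    (continuous_comp_norm_sq hφ) ht).congr_of_eventuallyEq ?_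
  filter_upwards [lt_mem_nhds ht] with s hs
  obtain ⟨B, hB⟩ := hw N s hs
  rw [moment_eq_ofReal (by linarith) (Nat.le_ceil _) (hB s le_rfl).1 (h.nonneg s hs.le)]
  simp only [hpow]
  refine ENNReal.toReal_ofReal (integral_nonneg_of_ae ?_)
  filter_upwards [h.nonneg s hs.le] with v hv
  positivity

end IsSolution

/-- By the mean value theorem each difference quotient at `0` is a derivative at some small `ξ > 0`,
hence at most `Φ (y ξ)`, which is close to `Φ (y 0)` by right continuity. -/
lemma upperRightDeriv_le_of_hasDerivAt {y y' Φ : ℝ → ℝ}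
    (hy : ContinuousWithinAt y (Ici 0) 0) (hd : ∀ t, 0 < t → HasDerivAt y (y' t) t)
    (hle : ∀ t, 0 < t → y' t ≤ Φ (y t)) (hΦ : Continuous Φ) :
    upperRightDeriv y 0 ≤ ((Φ (y 0) : ℝ) : EReal) := by
  refine EReal.le_of_forall_lt_iff_le.1 fun z hz => ?_
  have hz' : Φ (y 0) < z := by exact_mod_cast hz
  have hev : ∀ᶠ t in 𝓝[≥] (0 : ℝ), Φ (y t) < z :=
    (hΦ.continuousAt.comp_continuousWithinAt hy).eventually_lt_const hz'
  obtain ⟨u, hu, hus⟩ := mem_nhdsGE_iff_exists_Ico_subset.1 hev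
  have hu0 : 0 < u := hu
  refine limsup_le_of_le (by isBoundedDefault) ?_
  filter_upwards [Ioo_mem_nhdsGT hu0] with t ht
  have hcont : ContinuousOn y (Icc 0 t) := by
    intro s hs
    rcases hs.1.eq_or_lt with rfl | hs0
    · exact hy.mono Icc_subset_Ici_self
    · exact (hd s hs0).continuousAt.continuousWithinAt
  obtain ⟨ξ, hξ, hξe⟩ := exists_hasDerivAt_eq_slope y y' ht.1 hcont fun s hs => hd s hs.1
  rw [zero_add]
  rw [sub_zero] at hξe
  rw [← hξe]
  exact_mod_cast (hle ξ hξ.1).trans (hus ⟨hξ.1.le, hξ.2.trans ht.2⟩).le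

/-! ### Constants of the moment inequality and the energy bound -/

/-- The part of the constants which stems from the host medium. -/
lemma weakL_le_of_host {α β lam r c : ℝ} {F₁ : Vel → ℝ} {M : ℝ → ℝ≥0} (hr : 1 ≤ r)
    (hlam : 0 < lam) (h0 : 0 < α * (1 - β)) (h1 : α * (1 - β) < 1) (hc0 : 0 < c)
    (hF : IsDistribution F₁) (hM : ∀ s, 0 ≤ s → moment F₁ s = (M s : ℝ≥0∞))
    {φ : ℝ → ℝ}
    (hc : ∀ v w : Vel, collJ α β (fun v => φ (‖v‖ ^ 2)) v w ≤
        -(α * (1 - β) * (1 - α * (1 - β))) * φ (‖v‖ ^ 2) + c * ‖w‖ ^ (2 * r))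
    {N : ℕ} {f : Vel → ℝ} (h : IsPowerLike r φ) (hφ : HasGrowth N fun v => φ (‖v‖ ^ 2))
    (hf : WInt (N + 1) f) (hf0 : ∀ᵐ v, 0 ≤ f v) (hf1 : ∫ v, f v = 1) :
    weakL α β lam F₁ f (fun v => φ (‖v‖ ^ 2)) ≤
      odeRhs (1 / lam * (2 * c * M r + c * M (r + 1 / 2)))
        (1 / lam * (α * (1 - β) * (1 - α * (1 - β)) * M (1 / 2) + c * M r))
        (1 / lam * (α * (1 - β) * (1 - α * (1 - β)))) (1 + 1 / (2 * r))
        (∫ v, f v * φ (‖v‖ ^ 2)) := by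
  obtain ⟨hW, hm⟩ := host_moments hF hM
  have m1 := hm (1 / 2) (by norm_num)
  have m2 := hm r (by linarith)
  have m3 := hm (r + 1 / 2) (by linarith)
  simp only [show (2 : ℝ) * (1 / 2) = 1 by norm_num, Real.rpow_one] at m1
  have hp : ∀ v : Vel, ‖v‖ ^ (2 * (r + 1 / 2)) = ‖v‖ ^ (2 * r) * ‖v‖ := fun v => by
    rw [show 2 * (r + 1 / 2) = 2 * r + 1 by ring,
      Real.rpow_add' (norm_nonneg v) (by linarith), Real.rpow_one]
  simp only [hp] at m3
  have := weakL_le hr hlam h0 h1 hc0 hc h hφ hf hf0 hf1 hW hF.nonneg hF.integral_eq_one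
  rwa [m1, m2, m3] at this

section constants
variable (α β τ lam : ℝ) (M : ℝ → ℝ≥0)

/-- The coefficient of the loss term caused by collisions with the host medium. -/
noncomputable def lossConst : ℝ := 1 / lam * (α * (1 - β) * (1 - α * (1 - β)))

/-- The zeroth order coefficient of the moment inequality of order `r`. -/
noncomputable def constTerm (r c : ℝ) : ℝ :=
  1 + 1 / lam * (2 * c * M r + c * M (r + 1 / 2))

/-- The linear coefficient of the moment inequality of order `r`, for solutions with energy
at most `B`. -/
noncomputable def linTerm (r c B : ℝ) : ℝ :=
  1 + 1 / lam * (α * (1 - β) * (1 - α * (1 - β)) * M (1 / 2) + c * M r) +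
    (τ * 2 ^ (r + 1) * B) * (1 + τ * 2 ^ (r + 1) * B)

variable {α β τ lam}

lemma lossConst_pos (hlam : 0 < lam) (h0 : 0 < α * (1 - β)) (h1 : α * (1 - β) < 1) :
    0 < lossConst α β lam :=
  mul_pos (by positivity) (mul_pos h0 (by linarith))

lemma constTerm_pos (hlam : 0 < lam) (r : ℝ) {c : ℝ} (hc : 0 < c) :
    0 < constTerm lam M r c := by
  unfold constTerm
  have := (M r).2
  have := (M (r + 1 / 2)).2
  positivity

lemma linTerm_pos (hτ : 0 ≤ τ) (hlam : 0 < lam) (h0 : 0 < α * (1 - β)) (h1 : α * (1 - β) < 1)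
    (r : ℝ) {c B : ℝ} (hc : 0 < c) (hB : 0 ≤ B) : 0 < linTerm α β τ lam M r c B := by
  unfold linTerm
  have : 0 < α * (1 - β) * (1 - α * (1 - β)) := mul_pos h0 (by linarith)
  have := (M r).2
  have := (M (1 / 2)).2
  positivity

end constants

section ineq
variable {α β τ lam ε : ℝ} {M : ℝ → ℝ≥0} {F₁ : Vel → ℝ} {f : ℝ → Vel → ℝ}
  (hτ : 0 ≤ τ) (hlam : 0 < lam) (h0 : 0 < α * (1 - β)) (h1 : α * (1 - β) < 1)
  (hF : IsDistribution F₁) (hM : ∀ s, 0 ≤ s → moment F₁ s = (M s : ℝ≥0∞))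
  (hε0 : 0 ≤ ε) (hε1 : ε ≤ 1) (h : IsSolution τ lam α β ε F₁ f)
  {r c : ℝ} (hc0 : 0 < c)
include hτ hlam h0 h1 hF hM hε0 hε1 h hc0

/-- The summand `1` in `constTerm` absorbs the constant from `mul_weakQ_le`; the one in `linTerm`
keeps the coefficient positive even if the prescribed moments vanish. -/
lemma momentIneq_of_energy_le (hr : 1 ≤ r)
    (hc : ∀ φ, IsPowerLike r φ → ∀ v w : Vel, collJ α β (fun v => φ (‖v‖ ^ 2)) v w ≤
        -(α * (1 - β) * (1 - α * (1 - β))) * φ (‖v‖ ^ 2) + c * ‖w‖ ^ (2 * r))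
    {B : ℝ} (hB0 : 0 ≤ B) (hB : ∀ t, 0 ≤ t → moment (f t) 1 ≤ ENNReal.ofReal B) :
    MomentIneq τ lam α β ε F₁ f r (constTerm lam M r c) (linTerm α β τ lam M r c B)
      (lossConst α β lam) := by
  intro φ N hN hφ hgr t ht hw
  obtain ⟨hW, -⟩ := host_moments hF hM
  have hf1 := h.integral_eq_one hε0 hε1 h0.le h1.le hW ht
  have hf0 := h.nonneg t ht
  have e1 := weakL_le_of_host hr hlam h0 h1 hc0 hF hM (hc φ hφ) hφ hgr hw hf0 hf1
  have hen : ∫ v, f t v * ‖v‖ ^ 2 ≤ B := by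
    have h2 := hB t ht
    rw [moment_eq_ofReal zero_le_one (by norm_num) (h.wInt_two ht) hf0] at h2
    simp only [mul_one, Real.rpow_two] at h2
    exact (ENNReal.ofReal_le_ofReal_iff hB0).1 h2
  have e2 := mul_weakQ_le hε0 hε1 hτ hr hφ hgr hN hw hf0 hf1 hen hB0
  have e3 : 0 ≤ ∫ v, f t v * φ (‖v‖ ^ 2) := by
    refine integral_nonneg_of_ae ?_
    filter_upwards [hf0] with v hv
    exact mul_nonneg hv (hφ.nonneg _ (sq_nonneg _))
  rw [odeRhs] at e1 ⊢
  rw [rhs, constTerm, linTerm, lossConst]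
  linarith

/-- For `r = 1` granular collisions only help, so the inequality holds with energy parameter `0`.
This avoids circularity: the inequalities of higher order presuppose the energy bound derived from
this one. -/
lemma momentIneq_one
    (hc : ∀ φ, IsPowerLike 1 φ → ∀ v w : Vel, collJ α β (fun v => φ (‖v‖ ^ 2)) v w ≤
        -(α * (1 - β) * (1 - α * (1 - β))) * φ (‖v‖ ^ 2) + c * ‖w‖ ^ (2 * (1 : ℝ))) :
    MomentIneq τ lam α β ε F₁ f 1 (constTerm lam M 1 c) (linTerm α β τ lam M 1 c 0)
      (lossConst α β lam) := by
  intro φ N hN hφ hgr t ht hw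
  obtain ⟨hW, -⟩ := host_moments hF hM
  have hf1 := h.integral_eq_one hε0 hε1 h0.le h1.le hW ht
  have hf0 := h.nonneg t ht
  have e1 := weakL_le_of_host le_rfl hlam h0 h1 hc0 hF hM (hc φ hφ) hφ hgr hw hf0 hf1
  have e2 := mul_nonpos_of_nonneg_of_nonpos hτ (weakQ_nonpos (f := f t) hε0 hε1 hφ hf0)
  have e3 : 0 ≤ ∫ v, f t v * φ (‖v‖ ^ 2) := by
    refine integral_nonneg_of_ae ?_
    filter_upwards [hf0] with v hv
    exact mul_nonneg hv (hφ.nonneg _ (sq_nonneg _))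
  rw [odeRhs] at e1 ⊢
  rw [rhs, constTerm, linTerm, lossConst]
  linarith

/-- The energy is bounded in terms of the initial energy. -/
lemma energy_le
    (hc : ∀ φ, IsPowerLike 1 φ → ∀ v w : Vel, collJ α β (fun v => φ (‖v‖ ^ 2)) v w ≤
        -(α * (1 - β) * (1 - α * (1 - β))) * φ (‖v‖ ^ 2) + c * ‖w‖ ^ (2 * (1 : ℝ)))
    {d : ℝ} (hd1 : 1 ≤ d) (hd : ∀ x, d ≤ x → odeRhs (constTerm lam M 1 c)
      (linTerm α β τ lam M 1 c 0) (lossConst α β lam) (1 + 1 / (2 * 1)) x < -(2 * 1 * x))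
    {E : ℝ} (hE : moment (f 0) 1 ≤ ENNReal.ofReal E) {t : ℝ} (ht : 0 ≤ t) :
    moment (f t) 1 ≤ ENNReal.ofReal (max E d) :=
  h.moment_le_of_moment_zero_le hε0 hε1 h0.le h1.le (host_moments hF hM).1 le_rfl
    (momentIneq_one hτ hlam h0 h1 hF hM hε0 hε1 h hc0 hc) hd1 hd (le_max_right _ _)
    (hE.trans (ENNReal.ofReal_le_ofReal (le_max_left _ _))) ht

end ineq

end GranularBath

/-! ### Assembly of the proposition -/

open GranularBath

theorem proposition4p2 (r α β τ lam : ℝ) (hr : 1 ≤ r) (hα₀ : 0 < α) (hα₁ : α < 1)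
    (hβ₀ : 0 ≤ β) (hβ₁ : β < 1 / 2) (hτ : 0 ≤ τ) (hlam : 0 < lam) (M : ℝ → ℝ≥0) :
    ∃ (C K : ℝ) (A : ℝ → ℝ), 0 < C ∧ 0 < K ∧ (∀ E, 0 < A E) ∧
      (τ = 0 → ∀ E E', A E = A E') ∧
      ∀ (F₁ : GranularBath.Vel → ℝ), GranularBath.IsDistribution F₁ →
      (∀ s, 0 ≤ s → GranularBath.moment F₁ s = (M s : ℝ≥0∞)) →
      ∀ (ε : ℝ), 0 < ε → ε < 1 →
      ∀ (f : ℝ → GranularBath.Vel → ℝ), GranularBath.IsSolution τ lam α β ε F₁ f →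
      ∀ (E : ℝ), GranularBath.moment (f 0) 1 ≤ ENNReal.ofReal E →
      ∀ (Y : ℝ → ℝ≥0∞), (∀ t, Y t = GranularBath.moment (f t) r) →
        (∀ t, 0 < t → Y t < ⊤ ∧ DifferentiableAt ℝ (fun s => (Y s).toReal) t ∧
          deriv (fun s => (Y s).toReal) t ≤
            C + A E * (Y t).toReal - K * (Y t).toReal ^ (1 + 1 / (2 * r))) ∧
        (Y 0 < ⊤ →
          GranularBath.upperRightDeriv (fun s => (Y s).toReal) 0 ≤
            ((C + A E * (Y 0).toReal - K * (Y 0).toReal ^ (1 + 1 / (2 * r)) : ℝ) : EReal)) ∧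
        (Y 0 < ⊤ → ∃ B : ℝ≥0, ∀ t, 0 ≤ t → Y t ≤ (B : ℝ≥0∞)) := by
  have h0 : 0 < α * (1 - β) := mul_pos hα₀ (by linarith)
  have h1 : α * (1 - β) < 1 := by nlinarith
  obtain ⟨c₁, hc₁0, hc₁⟩ := exists_collJ_le (r := 1) le_rfl h0 h1
  obtain ⟨c, hc0, hc⟩ := exists_collJ_le hr h0 h1
  have hK := lossConst_pos hlam h0 h1
  -- The threshold `d` is fixed before `F₁`, `ε` and `f`, so the energy bound `max E d` may enter
  -- the constant `A E`.
  have hd := exists_odeRhs_neg (constTerm lam M 1 c₁) (linTerm α β τ lam M 1 c₁ 0)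
    (constTerm_pos M hlam 1 hc₁0).le hK le_rfl
  obtain ⟨d, hd1, hd⟩ := hd
  have hB0 : ∀ E, 0 ≤ max E d := fun E => le_max_of_le_right (by linarith)
  refine ⟨constTerm lam M r c, lossConst α β lam, fun E => linTerm α β τ lam M r c (max E d),
    constTerm_pos M hlam r hc0, hK, fun E => linTerm_pos M hτ hlam h0 h1 r hc0 (hB0 E),
    fun hτ0 E E' => by simp [linTerm, hτ0], ?_⟩
  intro F₁ hF hM ε hε0 hε1 f hf E hE Y hY
  obtain rfl : Y = fun t => moment (f t) r := funext hY
  have hW := (host_moments hF hM).1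
  have hen : ∀ t, 0 ≤ t → moment (f t) 1 ≤ ENNReal.ofReal (max E d) := fun t ht =>
    energy_le hτ hlam h0 h1 hF hM hε0.le hε1.le hf hc₁0 hc₁ hd1 hd hE ht
  -- All orders `s` are needed, not only `r`: differentiating the moment of order `r` uses bounds
  -- with higher weights.
  have hcreate : ∀ s, 1 ≤ s → ∃ e, 0 ≤ e ∧ ∀ t, 0 < t →
      moment (f t) s ≤ ENNReal.ofReal (e * (min t 1) ^ (-(2 * s))) := by
    intro s hs
    obtain ⟨c', hc'0, hc'⟩ := exists_collJ_le hs h0 h1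
    have hC' := constTerm_pos M hlam s hc'0
    have hA' := linTerm_pos M hτ hlam h0 h1 s hc'0 (hB0 E)
    obtain ⟨e, he1, he⟩ := exists_odeRhs_neg _ (linTerm α β τ lam M s c' (max E d)) hC'.le hK hs
    exact ⟨e, by linarith, fun t ht => hf.moment_le_rpow hε0.le hε1.le h0.le h1.le hW hs
      (momentIneq_of_energy_le hτ hlam h0 h1 hF hM hε0.le hε1.le hf hc'0 hs hc' (hB0 E) hen)
      hC'.le hA'.le he1 he ht⟩
  have hI := momentIneq_of_energy_le hτ hlam h0 h1 hF hM hε0.le hε1.le hf hc0 hr hc (hB0 E) hen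
  have hA := linTerm_pos M hτ hlam h0 h1 r hc0 (hB0 E)
  obtain ⟨e, he1, he⟩ := exists_odeRhs_neg _ (linTerm α β τ lam M r c (max E d))
    (constTerm_pos M hlam r hc0).le hK hr
  have hder := fun t (ht : 0 < t) =>
    hf.hasDerivAt_moment hε0.le hε1.le h0.le h1.le hW hr hcreate ht
  have hfin : ∀ t, 0 < t → moment (f t) r < ∞ := fun t ht => by
    obtain ⟨e, -, he⟩ := hcreate r hr
    exact (he t ht).trans_lt ENNReal.ofReal_lt_top
  have hle : ∀ t, 0 < t → rhs τ lam α β ε F₁ (f t) (fun v => (‖v‖ ^ 2) ^ r) ≤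
      odeRhs (constTerm lam M r c) (linTerm α β τ lam M r c (max E d)) (lossConst α β lam)
        (1 + 1 / (2 * r)) (moment (f t) r).toReal := by
    intro t ht
    set N := ⌈2 * r⌉₊ with hN
    have hN1 : 1 ≤ N := Nat.one_le_ceil_iff.2 (by linarith)
    obtain ⟨e', he'0, he'⟩ := hcreate (((N + 1 : ℕ) : ℝ) + 1)
      (by have : (0 : ℝ) ≤ ((N + 1 : ℕ) : ℝ) := Nat.cast_nonneg _
          linarith)
    have hw : WInt (N + 1) (f t) := (wInt_of_moment (N + 1) (hf.aemeasurable t ht.le)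
      (hf.nonneg t ht.le) (hf.mass_eq_one hε0.le hε1.le h0.le h1.le hW ht.le)
      (mul_nonneg he'0 (Real.rpow_nonneg (le_min ht.le zero_le_one) _)) (he' t ht)).1
    have hpow : ∀ v : Vel, (‖v‖ ^ 2) ^ r = ‖v‖ ^ (2 * r) := fun v => by
      rw [Real.rpow_mul (norm_nonneg v), Real.rpow_two]
    have hgr : HasGrowth N fun v => (‖v‖ ^ 2) ^ r := by
      simp only [hpow]
      exact hasGrowth_norm_rpow (by linarith)
    -- The class estimate is now applied to the untruncated power, with the same constants.
    have key := hI (fun x => x ^ r) N hN1 (isPowerLike_rpow hr) hgr t ht.le hw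
    have hmom : (moment (f t) r).toReal = ∫ v, f t v * (‖v‖ ^ 2) ^ r := by
      rw [moment_eq_ofReal (by linarith) (Nat.le_ceil _) (hw.mono (Nat.le_succ N))
        (hf.nonneg t ht.le)]
      simp only [hpow]
      refine ENNReal.toReal_ofReal (integral_nonneg_of_ae ?_)
      filter_upwards [hf.nonneg t ht.le] with v hv
      positivity
    rwa [hmom]
  refine ⟨fun t ht => ⟨hfin t ht, (hder t ht).differentiableAt, ?_⟩, fun hY0 => ?_, fun hY0 => ?_⟩
  · rw [(hder t ht).deriv]
    exact hle t ht
  · exact upperRightDeriv_le_of_hasDerivAt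
      (hf.continuousWithinAt_moment_zero hε0.le hε1.le h0.le h1.le hW hr hI hA.le hK.le he1 he hY0)
      hder hle (continuous_odeRhs _ _ _ (by positivity))
  · refine ⟨(max (moment (f 0) r).toReal e).toNNReal, fun t ht => ?_⟩
    refine hf.moment_le_of_moment_zero_le hε0.le hε1.le h0.le h1.le hW hr hI he1 he
      (le_max_right _ _) ?_ ht
    exact (ENNReal.ofReal_toReal hY0.ne).ge.trans (ENNReal.ofReal_le_ofReal (le_max_left _ _))
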